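/- **Theorem 4.2.** Let $1\le k\le n$ be integers, let $p>1$, $-1<\alpha<\frac1k-1$ and $\beta<p-1$ be real constants, and let $f:\mathbb R\to(0,+\infty)$ be continuous and non-decreasing. Consider $$S_k^{1/k}\big[D(|Du|^{p-2}Du)\big]=|x|^\alpha|Du|^\beta f(u)\quad\text{in }\mathbb R^n, \tag{1.5}$$ where $S_k[A]=\sum_{i_1<\dots<i_k}\lambda_{i_1}\cdots\lambda_{i_k}$ for a matrix $A$ with eigenvalues $\lambda=(\lambda_1,\dots,\lambda_n)$ (for $Du=0$ we put $|Du|^{p-2}Du=0$). An *entire nontrivial admissible subsolution* of (1.5) is a non-constant function $u\in C^1(\mathbb R^n)\cap C^2(\mathbb R^n\setminus\{0\})$ such that at every $x\ne0$ the field $|Du|^{p-2}Du$ is differentiable, the eigenvalues of $D(|Du|^{p-2}Du)(x)$ lie in $\Gamma_k=\{\lambda\in\mathbb R^n: S_i(\lambda)>0,\ i=1,\dots,k\}$, and $S_k^{1/k}[D(|Du|^{p-2}Du)]\ge|x|^\alpha|Du|^\beta f(u)$ (where $0^\beta=+\infty$ if $\beta<0$ and $0^0=1$). (a) Suppose that for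 some $\epsilon\in(0,k(\alpha+1))$, with $\kappa=\frac{1-\epsilon}{k(\alpha+1)-\epsilon}$, $$\int^{+\infty}\Big(\int_0^t f^{\kappa k}(s)\,ds\Big)^{-\frac1{\kappa k(p-\beta-1)+1}}dt=+\infty .$$ Then there is an entire nontrivial admissible subsolution $u$ of (1.5). Moreover, this $u$ has the following properties: (i) if $p\le\alpha+\beta+2$, then $u\in C^2(\mathbb R^n)$; (ii) if $p>\alpha+\beta+2$ and $(p-1)\alpha+\beta\ge0$, then $u\in W^{2,\delta}_{loc}(\mathbb R^n)$ for every $\delta\in\big(1,\frac{p-\beta-1}{p-\alpha-\beta-2}\big)$. (b) Conversely, suppose that (1.5) has an entire nontrivial admissible subsolution $u$ such that either $p\le\alpha+\beta+2$ and $u\in C^2(\mathbb R^n)$, or $p>\alpha+\beta+2$, $(p-1)\alpha+\beta\ge0$ and $u\in W^{2,\delta}_{loc}(\mathbb R^n)$ for some $\delta\in\big(1,\frac{p-\beta-1}{p-\alpha-\beta-2}\big)$. Then $$\int^{+\infty}\Big(\int_0^t f^{k}(s)\,ds\Big)^{-\frac1{k(p-\beta-1)+1}}dt=+\infty .$$ (In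 both conditions the lower limit of the outer integral is any positive number.) -/

import Mathlib

open MeasureTheory

open scoped ContDiff

noncomputable section

/-- The divergence of the improper integral `∫^{+∞} (∫_0^t g(s) ds)^{-1/(θ+1)} dt`,
for every positive lower limit. -/
def KellerOsserman (g : ℝ → ℝ) (θ : ℝ) : Prop :=
  ∀ c : ℝ, 0 < c →
    ∫⁻ t in Set.Ioi c, ENNReal.ofReal ((∫ s in (0 : ℝ)..t, g s) ^ (-(1 / (θ + 1)))) = ⊤

/-- The elementary symmetric polynomial `S_k(λ) = ∑_{i₁ < ⋯ < i_k} λ_{i₁} ⋯ λ_{i_k}`. -/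
def elemSymm {n : ℕ} (k : ℕ) (lam : Fin n → ℝ) : ℝ :=
  ∑ s ∈ Finset.powersetCard k (Finset.univ : Finset (Fin n)), ∏ i ∈ s, lam i

/-- Gårding's cone `Γ_k = {λ ∈ ℝⁿ | S_i(λ) > 0, i = 1, …, k}`. -/
def gardingCone (n k : ℕ) : Set (Fin n → ℝ) :=
  {lam | ∀ i ∈ Finset.Icc 1 k, 0 < elemSymm i lam}

/-- `lam` lists all the eigenvalues of `A`, which are then real, with algebraic multiplicity. -/
def IsEigenvalueVector {n : ℕ} (A : Matrix (Fin n) (Fin n) ℝ) (lam : Fin n → ℝ) : Prop :=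
  A.charpoly = ∏ i, (Polynomial.X - Polynomial.C (lam i))

/-- The vector field `|Du|^{p-2} Du`, which is zero where `Du = 0`. -/
def pGradient {n : ℕ} (p : ℝ) (u : EuclideanSpace ℝ (Fin n) → ℝ) (x : EuclideanSpace ℝ (Fin n)) :
    EuclideanSpace ℝ (Fin n) :=
  ‖gradient u x‖ ^ (p - 2) • gradient u x

/-- The Jacobian matrix `D(|Du|^{p-2} Du)`. -/
def pHessian {n : ℕ} (p : ℝ) (u : EuclideanSpace ℝ (Fin n) → ℝ) (x : EuclideanSpace ℝ (Fin n)) :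
    Matrix (Fin n) (Fin n) ℝ :=
  Matrix.of fun i j => fderiv ℝ (pGradient p u) x (EuclideanSpace.single j 1) i

/-- At the point `x ≠ 0`, the function `u` is admissible (`|Du|^{p-2} Du` is differentiable and the
eigenvalues of its derivative lie in `Γ_k`) and satisfies
`S_k^{1/k}[D(|Du|^{p-2} Du)] ≥ |x|^α |Du|^β f(u)`.
The inequality is between extended nonnegative reals, so that the right-hand side is `∞` where
`Du = 0` and `β < 0`; for `β = 0` the factor `|Du|^β` is `1`. -/
def IsAdmissibleSubsolutionAt {n : ℕ} (k : ℕ) (p α β : ℝ) (f : ℝ → ℝ)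
    (u : EuclideanSpace ℝ (Fin n) → ℝ) (x : EuclideanSpace ℝ (Fin n)) : Prop :=
  DifferentiableAt ℝ (pGradient p u) x ∧
    ∃ lam : Fin n → ℝ, IsEigenvalueVector (pHessian p u x) lam ∧ lam ∈ gardingCone n k ∧
      ENNReal.ofReal ‖x‖ ^ α * ENNReal.ofReal ‖gradient u x‖ ^ β * ENNReal.ofReal (f (u x)) ≤
        ENNReal.ofReal (elemSymm k lam ^ (1 / (k : ℝ)))

/-- An entire nontrivial admissible subsolution `u ∈ C¹(ℝⁿ) ∩ C²(ℝⁿ \ {0})` of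
`S_k^{1/k}[D(|Du|^{p-2} Du)] = |x|^α |Du|^β f(u)`. For `α < 0` the right-hand side is singular at
the origin, and the inequality and the admissibility are required at all other points. -/
structure IsEntireSubsolution {n : ℕ} (k : ℕ) (p α β : ℝ) (f : ℝ → ℝ)
    (u : EuclideanSpace ℝ (Fin n) → ℝ) : Prop where
  contDiff_one : ContDiff ℝ 1 u
  contDiffOn_two : ContDiffOn ℝ 2 u {0}ᶜ
  nontrivial : ¬ ∃ c : ℝ, ∀ x, u x = c
  subsolution : ∀ x, x ≠ 0 → IsAdmissibleSubsolutionAt k p α β f u x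

/-- `g ∈ L^δ_loc(ℝⁿ)`. -/
def MemLpLoc {n : ℕ} (δ : ℝ) (g : EuclideanSpace ℝ (Fin n) → ℝ) : Prop :=
  ∀ K : Set (EuclideanSpace ℝ (Fin n)), IsCompact K →
    MemLp g (ENNReal.ofReal δ) (volume.restrict K)

/-- `g` is the weak partial derivative `∂_i u` on `ℝⁿ`. -/
def HasWeakPartialDeriv {n : ℕ} (i : Fin n) (u g : EuclideanSpace ℝ (Fin n) → ℝ) : Prop :=
  LocallyIntegrable u ∧ LocallyIntegrable g ∧
    ∀ φ : EuclideanSpace ℝ (Fin n) → ℝ, ContDiff ℝ ∞ φ → HasCompactSupport φ →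
      ∫ x, u x * fderiv ℝ φ x (EuclideanSpace.single i 1) = -∫ x, g x * φ x

/-- `u ∈ W^{2,δ}_loc(ℝⁿ)`. -/
def MemW2Loc {n : ℕ} (δ : ℝ) (u : EuclideanSpace ℝ (Fin n) → ℝ) : Prop :=
  MemLpLoc δ u ∧
    ∃ (g : Fin n → EuclideanSpace ℝ (Fin n) → ℝ) (h : Fin n → Fin n → EuclideanSpace ℝ (Fin n) → ℝ),
      (∀ i, HasWeakPartialDeriv i u (g i) ∧ MemLpLoc δ (g i)) ∧
        ∀ i j, HasWeakPartialDeriv j (g i) (h i j) ∧ MemLpLoc δ (h i j)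

end

/-
Look for radial functions `u(x) = Φ(|x|^{1+m}/(1+m))` with `Φ' = G(Φ)`. Then `|Du| = G(u) r^m`, and
with `N = |Du|` the eigenvalues of `D(|Du|^{p-2} Du)` are `(p-1) N^{p-1} (G'(u) r^m + m/r)` once and
`N^{p-1}/r` with multiplicity `n - 1`, so that (1.5) becomes, up to constants,
`f^k ≤ G^q (G' r^{m+1} + m)` with `q = k(p-β-1)`, once `m` is chosen to match the powers of `r`.

(a) With `m = (α+1)/(p-β-1)` the inequality is scale free. Divergence of the integral for some
`κ ≥ 1` forces `∫^∞ (t f(t)^k)^{-1/(q+1)} dt = ∞`: otherwise the monotone integrand is `O(1/t)`, so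
that `f^k ≳ t^q`, and for such `f` raising `κ` only makes the integral smaller. Take
`G = H^{1/(q+1)}` where `H` is a primitive of a multiple of `f^k`, cut off on the negative axis.
Then `G^q G' = H'/(q+1)` and `H(t) ≲ t f(t)^k`, so `∫^∞ ds/G(s) = ∞` and `Φ` exists for all times.
Start `Φ` low enough that `r ≥ 1` wherever `u > 0`; the term `G' r^{m+1}` then suffices there, and
the term `m` where `u ≤ 0`.

(b) If the integral converges, then with `m = 1/(p-β-1)` there are radial barriers on balls of a
fixed large radius, zero at the centre and as large as we like on the boundary, which violate the
inequality strictly. At an interior maximum of `u - v` the `p`-Hessian of `u` is dominated by that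
of `v`, so that `u ≤ 0` on an annulus, and hence at the origin by the maximum principle; after
replacing `u` by `u - a` with `u(0) > a` this is a contradiction.
-/

section ElementarySymmetric

open Polynomial

theorem splits_derivative {P : ℝ[X]} (hP : P.Splits) : P.derivative.Splits := by
  rw [splits_iff_card_roots] at hP ⊢
  have := card_roots_le_derivative P
  have := card_roots' P.derivative
  rw [natDegree_derivative] at *
  omega

theorem two_mul_coeff_zero_mul_coeff_two_le {P : ℝ[X]} (hP : P.Splits) :
    2 * (P.coeff 0 * P.coeff 2) ≤ P.coeff 1 ^ 2 := by
  have monic_case (s : Multiset ℝ) :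
      let Q := (s.map fun a => X - C a).prod
      2 * (Q.coeff 0 * Q.coeff 2) ≤ Q.coeff 1 ^ 2 := by
    induction s using Multiset.induction_on with
    | empty => simp [coeff_one]
    | cons r s ih =>
      simp only [Multiset.map_cons, Multiset.prod_cons, sub_mul, coeff_sub, coeff_C_mul,
        coeff_X_mul_zero, coeff_X_mul _ 0, coeff_X_mul _ 1]
      set Q := (s.map fun a => X - C a).prod
      nlinarith [sq_nonneg (Q.coeff 0), mul_nonneg (sq_nonneg r) (sub_nonneg.2 ih)]
  rw [hP.eq_prod_roots]
  simp only [coeff_C_mul]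
  nlinarith [mul_nonneg (sq_nonneg P.leadingCoeff) (sub_nonneg.2 (monic_case P.roots))]

theorem newton_coeff_inequality (j : ℕ) {P : ℝ[X]} (hP : P.Splits) :
    (j + 2) * (P.coeff j * P.coeff (j + 2)) ≤ (j + 1) * P.coeff (j + 1) ^ 2 := by
  induction j generalizing P with
  | zero => simpa using two_mul_coeff_zero_mul_coeff_two_le hP
  | succ j ih =>
    have h := ih (splits_derivative hP)
    simp only [coeff_derivative] at h
    push_cast at h ⊢
    refine le_of_mul_le_mul_left ?_ (by positivity : (0 : ℝ) < (j + 1) * (j + 2))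
    linarith

variable {ι R : Type*} [CommRing R]

/-- The generating polynomial `∏ i ∈ I, (1 + λᵢ X) = ∑ j, S_j X ^ j` of the elementary symmetric
functions of the family `(λᵢ)` indexed by `I`. -/
noncomputable def symmGenPoly (I : Finset ι) (lam : ι → R) : R[X] :=
  ∏ i ∈ I, (1 + C (lam i) * X)

theorem elemSymm_eq_coeff_symmGenPoly {n : ℕ} (j : ℕ) (lam : Fin n → ℝ) :
    elemSymm j lam = (symmGenPoly Finset.univ lam).coeff j := by
  have coeff_term (t : Finset (Fin n)) : (∏ i ∈ t, (C (lam i) * X)).coeff j =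
      if t.card = j then ∏ i ∈ t, lam i else 0 := by
    rw [Finset.prod_mul_distrib, Finset.prod_const, ← map_prod, coeff_C_mul_X_pow]
    simp only [eq_comm]
  simp only [elemSymm, symmGenPoly, Finset.prod_one_add, finsetSum_coeff, coeff_term,
    Finset.powerset_univ, Finset.sum_ite, Finset.sum_const_zero, add_zero]
  exact Finset.sum_congr (by ext t; simp) fun _ _ => rfl

theorem splits_symmGenPoly (I : Finset ι) (lam : ι → ℝ) : (symmGenPoly I lam).Splits :=
  Splits.prod fun _ _ => Splits.of_natDegree_le_one (by compute_degree)

theorem coeff_zero_symmGenPoly (I : Finset ι) (lam : ι → R) : (symmGenPoly I lam).coeff 0 = 1 := by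
  simp [symmGenPoly, coeff_zero_prod]

theorem coeff_succ_symmGenPoly [DecidableEq ι] {I : Finset ι} {i : ι} (hi : i ∈ I) (lam : ι → R)
    (j : ℕ) :
    (symmGenPoly I lam).coeff (j + 1) =
      (symmGenPoly (I.erase i) lam).coeff (j + 1) +
        lam i * (symmGenPoly (I.erase i) lam).coeff j := by
  rw [symmGenPoly, ← Finset.mul_prod_erase I _ hi, add_mul, one_mul, mul_assoc, coeff_add,
    coeff_C_mul, coeff_X_mul]
  rfl

theorem coeff_symmGenPoly_erase_pos [DecidableEq ι] {I : Finset ι} {i : ι} (hi : i ∈ I)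
    {lam : ι → ℝ} {k : ℕ} (h : ∀ j < k, 0 < (symmGenPoly I lam).coeff (j + 1)) :
    ∀ j < k, 0 < (symmGenPoly (I.erase i) lam).coeff j := by
  set a := (symmGenPoly (I.erase i) lam).coeff with ha
  simp only [coeff_succ_symmGenPoly hi, ← ha] at h
  intro j
  induction j with
  | zero => simp [ha, coeff_zero_symmGenPoly]
  | succ j ih =>
    intro hj
    have haj : 0 < a j := ih (by omega)
    have h₁ : 0 < a (j + 1) + lam i * a j := h j (by omega)
    have h₂ : 0 < a (j + 2) + lam i * a (j + 1) := h (j + 1) hj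
    by_contra! hneg
    -- The two sums force `λᵢ > 0` and `a_{j+1}² < a_j a_{j+2}`, against Newton's inequality.
    have hlam : 0 < lam i := by
      by_contra! hlam
      linarith [mul_nonpos_of_nonpos_of_nonneg hlam haj.le]
    have ha₂ : 0 < a (j + 2) := by linarith [mul_nonpos_of_nonneg_of_nonpos hlam.le hneg]
    have hsq : a (j + 1) ^ 2 < a j * a (j + 2) := by
      calc a (j + 1) ^ 2 ≤ a j * (lam i * -a (j + 1)) := by nlinarith
        _ < a j * a (j + 2) := mul_lt_mul_of_pos_left (by linarith) haj
    have newton := newton_coeff_inequality j (splits_symmGenPoly (I.erase i) lam)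
    nlinarith [mul_pos haj ha₂]

end ElementarySymmetric

section Matrices

open Polynomial Matrix

variable {m : Type*} [Fintype m] [DecidableEq m]

theorem det_diagonal_add_vecMulVec_of_field {K : Type*} [Field K] {d : m → K} (hd : ∀ i, d i ≠ 0)
    (v w : m → K) :
    (diagonal d + vecMulVec v w).det =
      ∏ i, d i + ∑ i, v i * w i * ∏ l ∈ Finset.univ.erase i, d l := by
  have hunit : IsUnit (diagonal d).det := by
    rw [det_diagonal, isUnit_iff_ne_zero]
    exact Finset.prod_ne_zero_iff.2 fun i _ => hd i
  have hinv : (diagonal d)⁻¹ = diagonal fun i => (d i)⁻¹ :=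
    inv_eq_right_inv (by simp [hd])
  rw [vecMulVec_eq Unit, det_add_replicateCol_mul_replicateRow hunit, det_diagonal, hinv,
    det_unique, Matrix.add_apply, one_apply_eq, mul_add, mul_one, Matrix.mul_apply, Finset.mul_sum]
  congr 1
  refine Finset.sum_congr rfl fun i _ => ?_
  rw [mul_diagonal, ← Finset.mul_prod_erase Finset.univ d (Finset.mem_univ i),
    replicateRow_apply, replicateCol_apply]
  field_simp [hd i]

theorem det_diagonal_add_vecMulVec {R : Type*} [CommRing R] [IsDomain R] {d : m → R}
    (hd : ∀ i, d i ≠ 0) (v w : m → R) :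
    (diagonal d + vecMulVec v w).det =
      ∏ i, d i + ∑ i, v i * w i * ∏ l ∈ Finset.univ.erase i, d l := by
  let φ := algebraMap R (FractionRing R)
  have hφ : Function.Injective φ := IsFractionRing.injective R (FractionRing R)
  refine hφ ?_
  have key := det_diagonal_add_vecMulVec_of_field (d := fun i => φ (d i))
    (fun i => (map_ne_zero_iff φ hφ).2 (hd i)) (fun i => φ (v i)) fun i => φ (w i)
  simp only [map_add, map_sum, map_mul, map_prod, RingHom.map_det]
  rw [← key]
  congr 1
  ext i j
  simp [diagonal_apply, vecMulVec_apply]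

/-- The polynomial `det (1 + X A)`, whose coefficients are the elementary symmetric functions of
the eigenvalues of `A`. -/
noncomputable def detOneAddX {R : Type*} [CommRing R] (A : Matrix m m R) : R[X] :=
  det (1 + (X : R[X]) • A.map C)

theorem detOneAddX_eq_charpolyRev_comp {R : Type*} [CommRing R] (A : Matrix m m R) :
    detOneAddX A = A.charpolyRev.comp (-X) := by
  rw [detOneAddX, charpolyRev, ← coe_compRingHom_apply, RingHom.map_det]
  congr 1
  ext1 i j
  by_cases h : i = j <;> simp [h, one_apply, Matrix.sub_apply, Matrix.smul_apply]

theorem detOneAddX_congr {R : Type*} [CommRing R] {A B : Matrix m m R}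
    (h : A.charpoly = B.charpoly) : detOneAddX A = detOneAddX B := by
  rw [detOneAddX_eq_charpolyRev_comp, detOneAddX_eq_charpolyRev_comp, ← reverse_charpoly,
    ← reverse_charpoly, h]

theorem detOneAddX_diagonal_add_vecMulVec {R : Type*} [CommRing R] [IsDomain R] (lam v w : m → R) :
    detOneAddX (diagonal lam + vecMulVec v w) =
      symmGenPoly Finset.univ lam +
        ∑ i, C (v i * w i) * (X * symmGenPoly (Finset.univ.erase i) lam) := by
  have hne (i : m) : 1 + C (lam i) * X ≠ 0 := fun h0 => by
    simpa using congrArg (fun P : R[X] => P.coeff 0) h0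
  have key := det_diagonal_add_vecMulVec hne (fun i => X * C (v i)) fun i => C (w i)
  convert key using 1
  · rw [detOneAddX]
    congr 1
    ext1 i j
    by_cases h : i = j
    · subst h
      simp [vecMulVec_apply]
      ring
    · simp [h, vecMulVec_apply]
      ring
  · refine congrArg₂ _ rfl (Finset.sum_congr rfl fun i _ => ?_)
    rw [symmGenPoly, C_mul]
    ring

theorem detOneAddX_diagonal {R : Type*} [CommRing R] (lam : m → R) :
    detOneAddX (diagonal lam) = symmGenPoly Finset.univ lam := by
  rw [detOneAddX, symmGenPoly, ← det_diagonal]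
  congr 1
  ext1 i j
  by_cases h : i = j
  · subst h; simp
  · simp [h]

variable {n k : ℕ} {A B : Matrix (Fin n) (Fin n) ℝ} {lam : Fin n → ℝ}

theorem IsEigenvalueVector.detOneAddX_eq (h : IsEigenvalueVector A lam) :
    detOneAddX A = symmGenPoly Finset.univ lam := by
  rw [← detOneAddX_diagonal]
  exact detOneAddX_congr (h.trans (charpoly_diagonal lam).symm)

theorem IsEigenvalueVector.elemSymm_eq (h : IsEigenvalueVector A lam) (j : ℕ) :
    elemSymm j lam = (detOneAddX A).coeff j := by
  rw [h.detOneAddX_eq, elemSymm_eq_coeff_symmGenPoly]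

theorem isEigenvalueVector_zero : IsEigenvalueVector (0 : Matrix (Fin n) (Fin n) ℝ) 0 := by
  rw [← diagonal_zero]
  exact charpoly_diagonal _

theorem isEigenvalueVector_vecMulVec (v w : Fin n → ℝ) (i₀ : Fin n) :
    IsEigenvalueVector (vecMulVec v w) (Pi.single i₀ (v ⬝ᵥ w)) := by
  have hn : n - 1 + 1 = n := by have := i₀.2; omega
  rw [IsEigenvalueVector, charpoly_vecMulVec, ← Finset.mul_prod_erase _ _ (Finset.mem_univ i₀),
    Finset.prod_congr rfl (g := fun _ => (X : ℝ[X]))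
      (fun i hi => by simp [Finset.ne_of_mem_erase hi]),
    Finset.prod_const, Finset.card_erase_of_mem (Finset.mem_univ _), Finset.card_univ,
    Fintype.card_fin, Pi.single_eq_same, sub_mul, ← pow_succ', hn, smul_eq_C_mul]

theorem IsEigenvalueVector.add_scalar (h : IsEigenvalueVector A lam) (a : ℝ) :
    IsEigenvalueVector (A + scalar (Fin n) a) fun i => lam i + a := by
  have hcomp := charpoly_sub_scalar A (-a)
  rw [map_neg, sub_neg_eq_add, h, prod_comp] at hcomp
  refine hcomp.trans (Finset.prod_congr rfl fun i _ => ?_)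
  simp only [sub_comp, X_comp, C_comp, C_add, C_neg]
  ring

theorem exists_charpoly_add_vecMulVec_self_eq (hA : A.IsHermitian) (v : Fin n → ℝ) :
    ∃ w : Fin n → ℝ, (A + vecMulVec v v).charpoly =
      (diagonal hA.eigenvalues + vecMulVec w w).charpoly := by
  set U : Matrix (Fin n) (Fin n) ℝ := (hA.eigenvectorUnitary : Matrix (Fin n) (Fin n) ℝ)
  have hU_left : star U * U = 1 := Unitary.coe_star_mul_self hA.eigenvectorUnitary
  have hU_right : U * star U = 1 := Unitary.coe_mul_star_self hA.eigenvectorUnitary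
  have hspec : A = U * diagonal hA.eigenvalues * star U := by
    have := hA.spectral_theorem
    rw [Unitary.conjStarAlgAut_apply] at this
    simpa using this
  set w : Fin n → ℝ := star U *ᵥ v with hw
  have hv : U *ᵥ w = v := by rw [hw, mulVec_mulVec, hU_right, one_mulVec]
  have hvv : vecMulVec v v = U * vecMulVec w w * star U := by
    rw [mul_vecMulVec, vecMulVec_mul, hv, star_eq_conjTranspose,
      conjTranspose_eq_transpose_of_trivial, vecMul_transpose, hv]
  have hsum : A + vecMulVec v v = U * ((diagonal hA.eigenvalues + vecMulVec w w) * star U) := by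
    rw [add_mul, mul_add, ← mul_assoc, ← mul_assoc, ← hvv, ← hspec]
  exact ⟨w, by rw [hsum, charpoly_mul_comm, mul_assoc, hU_left, mul_one]⟩

theorem coeff_detOneAddX_le_add_vecMulVec (hA : A.IsHermitian)
    (hk : ∀ j ∈ Finset.Icc 1 k, 0 < (detOneAddX A).coeff j) (v : Fin n → ℝ) {j : ℕ} (hj : j ≤ k) :
    (detOneAddX A).coeff j ≤ (detOneAddX (A + vecMulVec v v)).coeff j := by
  obtain ⟨w, hw⟩ := exists_charpoly_add_vecMulVec_self_eq hA v
  have heig : IsEigenvalueVector A hA.eigenvalues := hA.charpoly_eq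
  rw [detOneAddX_congr hw, detOneAddX_diagonal_add_vecMulVec, heig.detOneAddX_eq]
  rw [heig.detOneAddX_eq] at hk
  cases j with
  | zero => simp
  | succ j =>
    rw [coeff_add, finsetSum_coeff]
    refine le_add_of_nonneg_right (Finset.sum_nonneg fun i _ => ?_)
    rw [coeff_C_mul, coeff_X_mul]
    refine mul_nonneg (mul_self_nonneg _) ?_
    exact (coeff_symmGenPoly_erase_pos (Finset.mem_univ i) (k := k)
      (fun l hl => hk (l + 1) (Finset.mem_Icc.2 ⟨by omega, by omega⟩)) j (by omega)).le

theorem coeff_detOneAddX_le_of_posSemidef_sub (hA : A.IsHermitian) (hAB : (B - A).PosSemidef)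
    (hk : ∀ j ∈ Finset.Icc 1 k, 0 < (detOneAddX A).coeff j) {j : ℕ} (hj : j ≤ k) :
    (detOneAddX A).coeff j ≤ (detOneAddX B).coeff j := by
  obtain ⟨l, v, hv⟩ := posSemidef_iff_eq_sum_vecMulVec.1 hAB
  have partial_sums (s : Finset (Fin l)) :
      (A + ∑ i ∈ s, vecMulVec (v i) (v i)).IsHermitian ∧
        ∀ j ≤ k, (detOneAddX A).coeff j ≤
          (detOneAddX (A + ∑ i ∈ s, vecMulVec (v i) (v i))).coeff j := by
    induction s using Finset.induction_on with
    | empty => simpa using hA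
    | insert i s hi ih =>
      obtain ⟨hherm, hle⟩ := ih
      rw [Finset.sum_insert hi, add_comm (vecMulVec _ _), ← add_assoc]
      refine ⟨hherm.add (posSemidef_vecMulVec_self_star (v i)).isHermitian, fun j hj => ?_⟩
      refine (hle j hj).trans (coeff_detOneAddX_le_add_vecMulVec hherm (fun l hl => ?_) _ hj)
      exact (hk l hl).trans_le (hle l (Finset.mem_Icc.1 hl).2)
  rw [sub_eq_iff_eq_add'.1 hv]
  exact (partial_sums Finset.univ).2 j hj

end Matrices

section SecondDerivativeTest

open Filter
open scoped RealInnerProductSpace Gradient Topology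

theorem nonpos_of_isLocalMax_of_hasDerivAt {φ φ' : ℝ → ℝ} {a c : ℝ} (h : IsLocalMax φ a)
    (hφ : ∀ᶠ t in 𝓝 a, HasDerivAt φ (φ' t) t) (hφ' : HasDerivAt φ' c a) : c ≤ 0 := by
  have hdd : deriv (deriv φ) a = c := by
    have heq : deriv φ =ᶠ[𝓝 a] φ' := hφ.mono fun t ht => ht.deriv
    rw [heq.deriv_eq, hφ'.deriv]
  by_contra! hc
  -- a positive second derivative makes `a` a local minimum too, so `φ` is locally constant
  have hmin := isLocalMin_of_deriv_deriv_pos (hdd.symm ▸ hc) h.deriv_eq_zero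
    hφ.self_of_nhds.continuousAt
  have heq : φ =ᶠ[𝓝 a] fun _ => φ a := by
    filter_upwards [h, hmin] with z h1 h2 using le_antisymm h1 h2
  have hzero : deriv (deriv φ) a = 0 := by simp [heq.deriv.deriv_eq]
  exact hc.ne (hzero.symm.trans hdd)

variable {E : Type*} [NormedAddCommGroup E] [InnerProductSpace ℝ E] [CompleteSpace E]
  {u v : E → ℝ} {x : E}

theorem differentiableAt_gradient (hu : ContDiffAt ℝ 2 u x) : DifferentiableAt ℝ (∇ u) x := by
  have h : ContDiffAt ℝ 1 (fderiv ℝ u) x := hu.fderiv_right (by norm_num)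
  exact (InnerProductSpace.toDual ℝ E).symm.toContinuousLinearEquiv.differentiableAt.comp x
    (h.differentiableAt one_ne_zero)

theorem inner_fderiv_gradient (hu : ContDiffAt ℝ 2 u x) (h h' : E) :
    ⟪fderiv ℝ (∇ u) x h, h'⟫ = fderiv ℝ (fderiv ℝ u) x h h' := by
  have hfd : fderiv ℝ u = fun z => innerSL ℝ (∇ u z) := by
    ext z w
    simp [inner_gradient_left]
  have hcomp : HasFDerivAt (fun z => innerSL ℝ (∇ u z)) _ x :=
    (innerSL ℝ).hasFDerivAt.comp x (differentiableAt_gradient hu).hasFDerivAt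
  rw [hfd, hcomp.fderiv]
  rfl

theorem isSymmetric_fderiv_gradient (hu : ContDiffAt ℝ 2 u x) :
    (fderiv ℝ (∇ u) x : E →ₗ[ℝ] E).IsSymmetric := fun h h' => by
  rw [real_inner_comm _ h]
  simpa only [ContinuousLinearMap.coe_coe, inner_fderiv_gradient hu] using
    (hu.isSymmSndFDerivAt (by simp)).eq h h'

theorem gradient_sub (hu : DifferentiableAt ℝ u x) (hv : DifferentiableAt ℝ v x) :
    ∇ (fun z => u z - v z) x = ∇ u x - ∇ v x := by
  simp only [gradient, fderiv_fun_sub hu hv, map_sub]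

theorem gradient_eq_of_isLocalMax_sub (hu : DifferentiableAt ℝ u x) (hv : DifferentiableAt ℝ v x)
    (hmax : IsLocalMax (fun z => u z - v z) x) : ∇ u x = ∇ v x := by
  rw [← sub_eq_zero, ← gradient_sub hu hv, gradient, hmax.fderiv_eq_zero, map_zero]

theorem inner_fderiv_gradient_nonpos_of_isLocalMax (hu : ContDiffAt ℝ 2 u x)
    (hmax : IsLocalMax u x) (h : E) : ⟪fderiv ℝ (∇ u) x h, h⟫ ≤ 0 := by
  have hline : ∀ t : ℝ, HasDerivAt (fun t : ℝ => x + t • h) h t := fun t => by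
    simpa only [one_smul, id] using ((hasDerivAt_id t).smul_const h).const_add x
  have hx : Tendsto (fun t : ℝ => x + t • h) (𝓝 0) (𝓝 x) := by
    simpa only [zero_smul, add_zero] using (hline 0).continuousAt.tendsto
  have hdiff : ∀ᶠ z in 𝓝 x, DifferentiableAt ℝ u z :=
    (hu.eventually (by simp)).mono fun z hz => hz.differentiableAt two_ne_zero
  have hgrad : HasFDerivAt (∇ u) (fderiv ℝ (∇ u) x) (x + (0 : ℝ) • h) := by
    simpa only [zero_smul, add_zero] using (differentiableAt_gradient hu).hasFDerivAt
  refine nonpos_of_isLocalMax_of_hasDerivAt (φ := fun t => u (x + t • h))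
    (φ' := fun t => ⟪∇ u (x + t • h), h⟫) (a := 0) ?_ ?_ ?_
  · simpa [IsLocalMax, IsMaxFilter] using hx.eventually hmax
  · filter_upwards [hx.eventually hdiff] with t ht
    rw [inner_gradient_left]
    exact ht.hasFDerivAt.comp_hasDerivAt t (hline t)
  · simpa using (hgrad.comp_hasDerivAt 0 (hline 0)).inner ℝ (hasDerivAt_const (0 : ℝ) h)

theorem isPositive_fderiv_gradient_sub_of_isLocalMax (hu : ContDiffAt ℝ 2 u x)
    (hv : ContDiffAt ℝ 2 v x) (hmax : IsLocalMax (fun z => u z - v z) x) :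
    (fderiv ℝ (∇ v) x - fderiv ℝ (∇ u) x : E →ₗ[ℝ] E).IsPositive := by
  have hsub : ∇ (fun z => u z - v z) =ᶠ[𝓝 x] fun z => ∇ u z - ∇ v z := by
    filter_upwards [hu.eventually (by simp), hv.eventually (by simp)] with z h3 h4
    exact gradient_sub (h3.differentiableAt two_ne_zero) (h4.differentiableAt two_ne_zero)
  refine ⟨(isSymmetric_fderiv_gradient hv).sub (isSymmetric_fderiv_gradient hu), fun h => ?_⟩
  have := inner_fderiv_gradient_nonpos_of_isLocalMax (hu.sub hv) hmax h
  rw [hsub.fderiv_eq,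
    fderiv_fun_sub (differentiableAt_gradient hu) (differentiableAt_gradient hv)] at this
  simp only [sub_apply, inner_sub_left] at this
  simpa [inner_sub_left] using this

end SecondDerivativeTest

section PHessian

open Matrix InnerProductSpace
open scoped RealInnerProductSpace Gradient

theorem hasFDerivAt_norm_of_ne_zero {E : Type*} [NormedAddCommGroup E] [InnerProductSpace ℝ E]
    {x : E} (hx : x ≠ 0) : HasFDerivAt (fun z : E => ‖z‖) (‖x‖⁻¹ • innerSL ℝ x) x := by
  have h := ((hasStrictFDerivAt_norm_sq x).hasFDerivAt).sqrt (by simpa using hx)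
  simp only [Real.sqrt_sq (norm_nonneg _)] at h
  refine h.congr_fderiv ?_
  rw [ofNat_smul_eq_nsmul, ← Nat.cast_smul_eq_nsmul ℝ, smul_smul]
  congr 1
  field_simp
  norm_num

theorem hasFDerivAt_radial_smul {E : Type*} [NormedAddCommGroup E] [InnerProductSpace ℝ E]
    {x : E} (hx : x ≠ 0) {χ : ℝ → ℝ} {c : ℝ} (hχ : HasDerivAt χ c ‖x‖) :
    HasFDerivAt (fun z : E => χ ‖z‖ • z) (χ ‖x‖ • 1 + (c / ‖x‖) • rankOne ℝ x x) x := by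
  have h : HasFDerivAt (fun z : E => χ ‖z‖ • z) _ x :=
    (hχ.comp_hasFDerivAt x (hasFDerivAt_norm_of_ne_zero hx)).smul (hasFDerivAt_id x)
  refine h.congr_fderiv ?_
  ext z
  simp [smul_smul, div_eq_mul_inv, mul_assoc]

theorem isPositive_smul_one_add_smul_rankOne {E : Type*} [NormedAddCommGroup E]
    [InnerProductSpace ℝ E] {a b : ℝ} {x : E} (ha : 0 ≤ a) (hab : 0 ≤ a + b * ‖x‖ ^ 2) :
    (a • 1 + b • rankOne ℝ x x : E →L[ℝ] E).IsPositive := by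
  rw [ContinuousLinearMap.isPositive_iff]
  refine ⟨?_, fun z => ?_⟩
  · intro y z
    simp [inner_add_left, inner_add_right, inner_smul_left, inner_smul_right, real_inner_comm x y,
      mul_comm ⟪x, z⟫]
  · have hcs : ⟪x, z⟫ ^ 2 ≤ ‖x‖ ^ 2 * ‖z‖ ^ 2 := by
      rw [← mul_pow]
      exact sq_le_sq' (neg_le_of_abs_le (abs_real_inner_le_norm x z)) (real_inner_le_norm x z)
    have hquad : ⟪(a • 1 + b • rankOne ℝ x x : E →L[ℝ] E) z, z⟫ =
        a * ‖z‖ ^ 2 + b * ⟪x, z⟫ ^ 2 := by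
      simp [inner_add_left, inner_smul_left, sq]
    rw [hquad]
    rcases le_total 0 b with hb | hb
    · positivity
    · nlinarith [sq_nonneg ‖z‖]

variable {n : ℕ} {p : ℝ} {u v : EuclideanSpace ℝ (Fin n) → ℝ} {x : EuclideanSpace ℝ (Fin n)}

theorem symm_toEuclideanCLM_apply
    (T : EuclideanSpace ℝ (Fin n) →L[ℝ] EuclideanSpace ℝ (Fin n)) (i j : Fin n) :
    (toEuclideanCLM (𝕜 := ℝ)).symm T i j = T (EuclideanSpace.single j 1) i := by
  obtain ⟨A, rfl⟩ := EquivLike.surjective (toEuclideanCLM (n := Fin n) (𝕜 := ℝ)) T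
  rw [StarAlgEquiv.symm_apply_apply]
  simp

theorem pHessian_eq_symm_toEuclideanCLM :
    pHessian p u x = (toEuclideanCLM (𝕜 := ℝ)).symm (fderiv ℝ (pGradient p u) x) := by
  ext i j
  rw [symm_toEuclideanCLM_apply, pHessian, of_apply]

theorem symm_toEuclideanCLM_smul_one_add_smul_rankOne (a b : ℝ) (x : EuclideanSpace ℝ (Fin n)) :
    (toEuclideanCLM (𝕜 := ℝ)).symm (a • 1 + b • rankOne ℝ x x) =
      vecMulVec (b • x.ofLp) x.ofLp + scalar (Fin n) a := by
  ext i j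
  rw [symm_toEuclideanCLM_apply]
  simp [vecMulVec_apply, diagonal_apply, EuclideanSpace.inner_single_right]
  ring

theorem posSemidef_symm_toEuclideanCLM
    {T : EuclideanSpace ℝ (Fin n) →L[ℝ] EuclideanSpace ℝ (Fin n)} (hT : T.IsPositive) :
    ((toEuclideanCLM (𝕜 := ℝ)).symm T).PosSemidef := by
  obtain ⟨A, rfl⟩ := EquivLike.surjective (toEuclideanCLM (n := Fin n) (𝕜 := ℝ)) T
  rw [StarAlgEquiv.symm_apply_apply, ← isPositive_toEuclideanLin_iff,
    ← coe_toEuclideanCLM_eq_toEuclideanLin]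
  exact hT.toLinearMap

theorem isHermitian_symm_toEuclideanCLM
    {T : EuclideanSpace ℝ (Fin n) →L[ℝ] EuclideanSpace ℝ (Fin n)}
    (hT : (T : _ →ₗ[ℝ] EuclideanSpace ℝ (Fin n)).IsSymmetric) :
    ((toEuclideanCLM (𝕜 := ℝ)).symm T).IsHermitian := by
  obtain ⟨A, rfl⟩ := EquivLike.surjective (toEuclideanCLM (n := Fin n) (𝕜 := ℝ)) T
  rwa [StarAlgEquiv.symm_apply_apply, ← isSymmetric_toEuclideanLin_iff,
    ← coe_toEuclideanCLM_eq_toEuclideanLin]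

/-- `D(|g|^{p-2} g)`, the derivative of the vector field `z ↦ |z|^{p-2} z` at `g ≠ 0`. -/
noncomputable def pFluxDeriv (p : ℝ) (g : EuclideanSpace ℝ (Fin n)) :
    EuclideanSpace ℝ (Fin n) →L[ℝ] EuclideanSpace ℝ (Fin n) :=
  ‖g‖ ^ (p - 2) • 1 + ((p - 2) * ‖g‖ ^ (p - 2 - 1) / ‖g‖) • rankOne ℝ g g

theorem isPositive_pFluxDeriv (hp : 1 ≤ p) {g : EuclideanSpace ℝ (Fin n)} (hg : g ≠ 0) :
    (pFluxDeriv p g).IsPositive := by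
  have hg0 : 0 < ‖g‖ := norm_pos_iff.2 hg
  refine isPositive_smul_one_add_smul_rankOne (by positivity) ?_
  have : ‖g‖ ^ (p - 2) + (p - 2) * ‖g‖ ^ (p - 2 - 1) / ‖g‖ * ‖g‖ ^ 2 =
      (p - 1) * ‖g‖ ^ (p - 2) := by
    rw [Real.rpow_sub_one hg0.ne']
    field_simp
    ring
  rw [this]
  exact mul_nonneg (by linarith) (by positivity)

theorem hasFDerivAt_pGradient (hu : ContDiffAt ℝ 2 u x) (hg : ∇ u x ≠ 0) :
    HasFDerivAt (pGradient p u) (pFluxDeriv p (∇ u x) * fderiv ℝ (∇ u) x) x := by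
  have hflux : HasFDerivAt (fun z => ‖z‖ ^ (p - 2) • z) (pFluxDeriv p (∇ u x)) (∇ u x) :=
    hasFDerivAt_radial_smul hg (χ := fun r => r ^ (p - 2))
      (Real.hasDerivAt_rpow_const (Or.inl (norm_ne_zero_iff.2 hg)))
  exact hflux.comp x (differentiableAt_gradient hu).hasFDerivAt

open scoped MatrixOrder in
theorem exists_eq_conjTranspose_mul_self {S : Matrix (Fin n) (Fin n) ℝ} (hS : S.PosSemidef) :
    ∃ Q : Matrix (Fin n) (Fin n) ℝ, S = Qᴴ * Q :=
  CStarAlgebra.nonneg_iff_eq_star_mul_self.1 hS.nonneg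

theorem charpoly_conjTranspose_mul_self_mul (Q H : Matrix (Fin n) (Fin n) ℝ) :
    (Qᴴ * Q * H).charpoly = (Q * H * Qᴴ).charpoly := by
  rw [mul_assoc, charpoly_mul_comm]

-- `D(|Du|^{p-2} Du) = S D²u` with `S ≥ 0` determined by `Du(x) = Dv(x)`, and for `S = QᴴQ` this has
-- the eigenvalues of the symmetric matrix `Q D²u Qᴴ`, which is monotone in `D²u`.
theorem elemSymm_le_of_isLocalMax_sub {k : ℕ} (hp : 1 ≤ p) (hu : ContDiffAt ℝ 2 u x)
    (hv : ContDiffAt ℝ 2 v x) (hmax : IsLocalMax (fun z => u z - v z) x) (hg : ∇ u x ≠ 0)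
    {lam mu : Fin n → ℝ} (hlam : IsEigenvalueVector (pHessian p u x) lam)
    (hmu : IsEigenvalueVector (pHessian p v x) mu) (hcone : lam ∈ gardingCone n k) :
    elemSymm k lam ≤ elemSymm k mu := by
  have hgrad : ∇ u x = ∇ v x := gradient_eq_of_isLocalMax_sub
    (hu.differentiableAt two_ne_zero) (hv.differentiableAt two_ne_zero) hmax
  let toMatrix := (toEuclideanCLM (n := Fin n) (𝕜 := ℝ)).symm
  obtain ⟨Q, hQ⟩ := exists_eq_conjTranspose_mul_self
    (posSemidef_symm_toEuclideanCLM (isPositive_pFluxDeriv hp hg))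
  have hfactor : ∀ {w : EuclideanSpace ℝ (Fin n) → ℝ}, ContDiffAt ℝ 2 w x → ∇ w x = ∇ u x →
      (pHessian p w x).charpoly = (Q * toMatrix (fderiv ℝ (∇ w) x) * Qᴴ).charpoly := by
    intro w hw hgw
    rw [pHessian_eq_symm_toEuclideanCLM, (hasFDerivAt_pGradient hw (hgw ▸ hg)).fderiv, hgw, map_mul,
      hQ, charpoly_conjTranspose_mul_self_mul]
  have hlam' : IsEigenvalueVector (Q * toMatrix (fderiv ℝ (∇ u) x) * Qᴴ) lam :=
    (hfactor hu rfl).symm.trans hlam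
  have hmu' : IsEigenvalueVector (Q * toMatrix (fderiv ℝ (∇ v) x) * Qᴴ) mu :=
    (hfactor hv hgrad.symm).symm.trans hmu
  have hherm : (Q * toMatrix (fderiv ℝ (∇ u) x) * Qᴴ).IsHermitian :=
    isHermitian_mul_mul_conjTranspose Q
      (isHermitian_symm_toEuclideanCLM (isSymmetric_fderiv_gradient hu))
  have hpsd : (Q * toMatrix (fderiv ℝ (∇ v) x) * Qᴴ -
      Q * toMatrix (fderiv ℝ (∇ u) x) * Qᴴ).PosSemidef := by
    rw [← sub_mul, ← mul_sub, ← map_sub]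
    exact (posSemidef_symm_toEuclideanCLM <| (ContinuousLinearMap.isPositive_toLinearMap_iff _).1
      (isPositive_fderiv_gradient_sub_of_isLocalMax hu hv hmax)).mul_mul_conjTranspose_same Q
  rw [hlam'.elemSymm_eq, hmu'.elemSymm_eq]
  refine coeff_detOneAddX_le_of_posSemidef_sub hherm hpsd (fun j hj => ?_) le_rfl
  rw [← hlam'.elemSymm_eq]
  exact hcone j hj

end PHessian

section AutonomousODE

open Filter

variable {G : ℝ → ℝ}

theorem tendsto_integral_inv_atTop_of_le (hG : Continuous G) (hpos : ∀ s, 0 < G s) {a M : ℝ}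
    (hM : ∀ s, a ≤ s → G s ≤ M) : Tendsto (fun s => ∫ r in a..s, (G r)⁻¹) atTop atTop := by
  have hM0 : 0 < M := (hpos a).trans_le (hM a le_rfl)
  have hlin : Tendsto (fun s => (s - a) * M⁻¹) atTop atTop :=
    (tendsto_atTop_add_const_right _ (-a) tendsto_id).atTop_mul_const (inv_pos.2 hM0)
  refine tendsto_atTop_mono' _ ?_ hlin
  filter_upwards [eventually_ge_atTop a] with s hs
  have hc : Continuous fun r => (G r)⁻¹ := hG.inv₀ fun r => (hpos r).ne'
  simpa using intervalIntegral.integral_mono_on (μ := volume) hs (f := fun _ => M⁻¹)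
    intervalIntegrable_const (hc.intervalIntegrable a s)
    (fun r hr => inv_anti₀ (hpos r) (hM r hr.1))

theorem tendsto_integral_inv_atBot_of_le (hG : Continuous G) (hpos : ∀ s, 0 < G s) {a M : ℝ}
    (hM : ∀ s, s ≤ a → G s ≤ M) : Tendsto (fun s => ∫ r in a..s, (G r)⁻¹) atBot atBot := by
  have hreflect := tendsto_integral_inv_atTop_of_le (G := fun s => G (-s)) (a := -a) (M := M)
    (hG.comp continuous_neg) (fun s => hpos _) (fun s hs => hM _ (by linarith))
  refine (tendsto_neg_atTop_atBot.comp (hreflect.comp tendsto_neg_atBot_atTop)).congr fun s => ?_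
  simp only [Function.comp]
  rw [intervalIntegral.integral_comp_neg (fun r => (G r)⁻¹), neg_neg, neg_neg,
    intervalIntegral.integral_symm, neg_neg]

-- Separation of variables: `Φ` is the inverse of the time map `s ↦ ∫_a^s dr / G(r)`.
theorem exists_hasDerivAt_comp_self (hG : Continuous G) (hpos : ∀ s, 0 < G s) (a : ℝ)
    (hbot : Tendsto (fun s => ∫ r in a..s, (G r)⁻¹) atBot atBot)
    (htop : Tendsto (fun s => ∫ r in a..s, (G r)⁻¹) atTop atTop) :
    ∃ Φ : ℝ → ℝ, (∀ t, HasDerivAt Φ (G (Φ t)) t) ∧ StrictMono Φ ∧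
      ∀ s, Φ (∫ r in a..s, (G r)⁻¹) = s := by
  have hc : Continuous fun r => (G r)⁻¹ := hG.inv₀ fun r => (hpos r).ne'
  set τ : ℝ → ℝ := fun s => ∫ r in a..s, (G r)⁻¹
  have hder : ∀ s, HasDerivAt τ (G s)⁻¹ s := fun s => (hc.integral_hasStrictDerivAt a s).hasDerivAt
  have hmono : StrictMono τ := strictMono_of_deriv_pos fun s => by
    rw [(hder s).deriv]
    exact inv_pos.2 (hpos s)
  have hcont : Continuous τ := continuous_iff_continuousAt.2 fun s => (hder s).continuousAt
  let e := hmono.orderIsoOfSurjective τ (hcont.surjective htop hbot)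
  refine ⟨e.symm, fun t => ?_, e.symm.strictMono, fun s => e.symm_apply_apply s⟩
  simpa using HasDerivAt.of_local_left_inverse (f := τ) (g := e.symm) (a := t)
    e.symm.continuous.continuousAt (hder _) (inv_ne_zero (hpos _).ne')
    (Eventually.of_forall e.apply_symm_apply)

theorem contDiff_two_of_hasDerivAt_comp_self {G' Φ : ℝ → ℝ} (hG : ∀ s, HasDerivAt G (G' s) s)
    (hG' : Continuous G') (hΦ : ∀ t, HasDerivAt Φ (G (Φ t)) t) : ContDiff ℝ 2 Φ := by
  have hG1 : ContDiff ℝ 1 G := contDiff_one_iff_deriv.2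
    ⟨fun s => (hG s).differentiableAt, by rwa [show deriv G = G' from funext fun s => (hG s).deriv]⟩
  have hderiv : deriv Φ = fun t => G (Φ t) := funext fun t => (hΦ t).deriv
  have hdiff : Differentiable ℝ Φ := fun t => (hΦ t).differentiableAt
  have hΦ1 : ContDiff ℝ 1 Φ := contDiff_one_iff_deriv.2
    ⟨hdiff, by rw [hderiv]; exact hG1.continuous.comp hdiff.continuous⟩
  rw [show (2 : ℕ∞ω) = 1 + 1 by norm_num, contDiff_succ_iff_deriv]
  exact ⟨hdiff, by simp, hderiv ▸ hG1.comp hΦ1⟩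

end AutonomousODE

section Speed

/-- The function `G = H^{1/(q+1)}`, which satisfies `G^q G' = H' / (q+1)`. The radial profiles are
solutions of `Φ' = G(Φ)` for suitable `H`, up to a rescaling of time. -/
noncomputable def speed (q : ℝ) (H : ℝ → ℝ) (s : ℝ) : ℝ :=
  H s ^ (1 / (q + 1))

/-- The derivative of `speed q H` when `g` is the derivative of `H`. -/
noncomputable def speedDeriv (q : ℝ) (H g : ℝ → ℝ) (s : ℝ) : ℝ :=
  g s * (1 / (q + 1)) * H s ^ (1 / (q + 1) - 1)

variable {q s : ℝ} {H g : ℝ → ℝ}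

theorem hasDerivAt_speed (hH : HasDerivAt H (g s) s) (hpos : 0 < H s) :
    HasDerivAt (speed q H) (speedDeriv q H g s) s :=
  hH.rpow_const (p := 1 / (q + 1)) (Or.inl hpos.ne')

theorem continuous_speed (hH : Continuous H) (hpos : ∀ s, 0 < H s) : Continuous (speed q H) :=
  hH.rpow_const fun s => Or.inl (hpos s).ne'

theorem continuous_speedDeriv (hH : Continuous H) (hg : Continuous g) (hpos : ∀ s, 0 < H s) :
    Continuous (speedDeriv q H g) :=
  (hg.mul continuous_const).mul (hH.rpow_const fun s => Or.inl (hpos s).ne')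

theorem speed_pos (hpos : 0 < H s) : 0 < speed q H s :=
  Real.rpow_pos_of_pos hpos _

theorem speedDeriv_nonneg (hq : 0 < q) (hpos : 0 < H s) (hg : 0 ≤ g s) :
    0 ≤ speedDeriv q H g s := by
  unfold speedDeriv
  positivity

theorem speed_rpow (hpos : 0 < H s) : speed q H s ^ q = H s ^ (q / (q + 1)) := by
  rw [speed, ← Real.rpow_mul hpos.le, one_div_mul_eq_div]

theorem speed_rpow_mul_speedDeriv (hq : 0 < q) (hpos : 0 < H s) :
    speed q H s ^ q * speedDeriv q H g s = g s / (q + 1) := by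
  have hcancel : H s ^ (q / (q + 1)) * H s ^ (1 / (q + 1) - 1) = 1 := by
    rw [← Real.rpow_add hpos, show q / (q + 1) + (1 / (q + 1) - 1) = 0 by field_simp; ring,
      Real.rpow_zero]
  rw [speed_rpow hpos, speedDeriv]
  linear_combination (g s * (1 / (q + 1))) * hcancel

theorem integral_eq_zero_of_le {a : ℝ} (ha : ∀ s ≤ a, g s = 0) (hs : s ≤ a) :
    ∫ r in a..s, g r = 0 := by
  rw [intervalIntegral.integral_symm, neg_eq_zero]
  refine intervalIntegral.integral_zero_ae (Filter.Eventually.of_forall fun r hr => ?_)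
  rw [Set.uIoc_of_le hs] at hr
  exact ha r hr.2

theorem integral_nonneg_of_eq_zero_of_le {a : ℝ} (hg : ∀ s, 0 ≤ g s) (ha : ∀ s ≤ a, g s = 0)
    (s : ℝ) : 0 ≤ ∫ r in a..s, g r := by
  rcases le_total a s with h | h
  · exact intervalIntegral.integral_nonneg h fun r _ => hg r
  · exact (integral_eq_zero_of_le ha h).ge

end Speed

section Radial

open scoped RealInnerProductSpace Gradient
open Matrix

/-- The radial function `Φ(|x - y|^{1+m} / (1+m))`. -/
noncomputable def radialFun {n : ℕ} (Φ : ℝ → ℝ) (m : ℝ) (y x : EuclideanSpace ℝ (Fin n)) : ℝ :=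
  Φ (‖x - y‖ ^ (1 + m) / (1 + m))

/-- The value of `|Du|^{p-1}` at distance `r` from the centre of a radial function with profile `Φ`,
where `Φ' = G(Φ)`. -/
noncomputable def radialFlux (p m : ℝ) (Φ G : ℝ → ℝ) (r : ℝ) : ℝ :=
  (G (Φ (r ^ (1 + m) / (1 + m))) * r ^ m) ^ (p - 1)

variable {n : ℕ} {p m r : ℝ} {Φ G G' : ℝ → ℝ} {x y : EuclideanSpace ℝ (Fin n)}

theorem hasGradientAt_radialFun (hm : 0 < m) {c : ℝ}
    (hΦ : HasDerivAt Φ c (‖x - y‖ ^ (1 + m) / (1 + m))) :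
    HasGradientAt (radialFun Φ m y) ((c * ‖x - y‖ ^ (m - 1)) • (x - y)) x := by
  have hnorm := (hasFDerivAt_norm_rpow (x - y) (p := 1 + m) (by linarith)).comp x
    ((hasFDerivAt_id x).sub_const y)
  have hcomp := hΦ.comp_hasFDerivAt x (hnorm.mul_const (1 + m)⁻¹)
  rw [hasGradientAt_iff_hasFDerivAt]
  refine HasFDerivAt.congr_fderiv (f := radialFun Φ m y) hcomp ?_
  ext1 h
  have : (1 + m) ≠ 0 := by positivity
  simp only [FunLike.coe_smul, ContinuousLinearMap.coe_comp, Pi.smul_apply,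
    Function.comp, innerSL_apply_apply, InnerProductSpace.toDual_apply_apply, inner_smul_left,
    smul_eq_mul, ContinuousLinearMap.coe_id', id, show 1 + m - 2 = m - 1 by ring, conj_trivial]
  field_simp

theorem gradient_radialFun (hm : 0 < m) (hΦ : ∀ t, HasDerivAt Φ (G (Φ t)) t)
    (x : EuclideanSpace ℝ (Fin n)) :
    ∇ (radialFun Φ m y) x = (G (radialFun Φ m y x) * ‖x - y‖ ^ (m - 1)) • (x - y) :=
  (hasGradientAt_radialFun hm (hΦ _)).gradient

theorem norm_gradient_radialFun (hm : 0 < m) (hΦ : ∀ t, HasDerivAt Φ (G (Φ t)) t)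
    (hG : 0 ≤ G (radialFun Φ m y x)) (hx : x ≠ y) :
    ‖∇ (radialFun Φ m y) x‖ = G (radialFun Φ m y x) * ‖x - y‖ ^ m := by
  have hr : 0 < ‖x - y‖ := norm_pos_iff.2 (sub_ne_zero.2 hx)
  rw [gradient_radialFun hm hΦ, norm_smul, Real.norm_of_nonneg (by positivity), mul_assoc,
    Real.rpow_sub_one hr.ne', div_mul_cancel₀ _ hr.ne']

theorem norm_gradient_radialFun_rpow (hm : 0 < m) (hΦ : ∀ t, HasDerivAt Φ (G (Φ t)) t)
    (hG : 0 ≤ G (radialFun Φ m y x)) (hx : x ≠ y) :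
    ‖∇ (radialFun Φ m y) x‖ ^ (p - 1) = radialFlux p m Φ G ‖x - y‖ := by
  rw [norm_gradient_radialFun hm hΦ hG hx]
  rfl

theorem contDiff_radialFun {l : ℕ∞ω} (hΦ : ContDiff ℝ l Φ)
    (hnorm : ContDiff ℝ l fun z : EuclideanSpace ℝ (Fin n) => ‖z‖ ^ (1 + m)) :
    ContDiff ℝ l (radialFun Φ m y) :=
  hΦ.comp ((hnorm.comp (contDiff_id.sub contDiff_const)).div_const _)

theorem contDiffAt_radialFun {l : ℕ∞ω} (hΦ : ContDiff ℝ l Φ) (hx : x ≠ y) :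
    ContDiffAt ℝ l (radialFun Φ m y) x := by
  have hxy : x - y ≠ 0 := sub_ne_zero.2 hx
  have hnorm : ContDiffAt ℝ l (fun z => ‖z - y‖) x :=
    (contDiffAt_norm ℝ hxy).comp x (contDiffAt_id.sub contDiffAt_const)
  exact hΦ.contDiffAt.comp x ((hnorm.rpow_const_of_ne (norm_ne_zero_iff.2 hxy)).div_const _)

theorem hasDerivAt_rpow_one_add_div (hm : 0 ≤ m) (hr : 0 < r) :
    HasDerivAt (fun r : ℝ => r ^ (1 + m) / (1 + m)) (r ^ m) r := by
  refine ((Real.hasDerivAt_rpow_const (Or.inl hr.ne')).div_const (1 + m)).congr_deriv ?_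
  rw [add_sub_cancel_left, mul_div_cancel_left₀ _ (by positivity)]

theorem hasDerivAt_radialFlux (hm : 0 ≤ m) (hr : 0 < r) (hG : ∀ s, HasDerivAt G (G' s) s)
    (hGpos : ∀ s, 0 < G s) (hΦ : ∀ t, HasDerivAt Φ (G (Φ t)) t) :
    HasDerivAt (radialFlux p m Φ G) ((p - 1) * radialFlux p m Φ G r *
      (G' (Φ (r ^ (1 + m) / (1 + m))) * r ^ m + m / r)) r := by
  have hspeed := (hG _).comp r ((hΦ _).comp r (hasDerivAt_rpow_one_add_div hm hr))
  have hmodulus := hspeed.mul (Real.hasDerivAt_rpow_const (x := r) (p := m) (Or.inl hr.ne'))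
  have hGr := hGpos (Φ (r ^ (1 + m) / (1 + m)))
  have hpos : 0 < G (Φ (r ^ (1 + m) / (1 + m))) * r ^ m := by positivity
  refine HasDerivAt.congr_deriv (f := radialFlux p m Φ G)
    (hmodulus.rpow_const (p := p - 1) (Or.inl hpos.ne')) ?_
  simp only [Function.comp, Pi.mul_apply, radialFlux]
  rw [Real.rpow_sub_one hpos.ne' (p - 1), Real.rpow_sub_one hr.ne']
  have := Real.rpow_pos_of_pos hr m
  field_simp

theorem pGradient_radialFun (hm : 0 < m) (hGpos : ∀ s, 0 < G s)
    (hΦ : ∀ t, HasDerivAt Φ (G (Φ t)) t) (z : EuclideanSpace ℝ (Fin n)) :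
    pGradient p (radialFun Φ m y) z =
      (radialFlux p m Φ G ‖z - y‖ / ‖z - y‖) • (z - y) := by
  rcases eq_or_ne z y with rfl | hz
  · simp [pGradient, gradient_radialFun hm hΦ]
  have hr : 0 < ‖z - y‖ := norm_pos_iff.2 (sub_ne_zero.2 hz)
  have hGz := hGpos (radialFun Φ m y z)
  rw [pGradient, norm_gradient_radialFun hm hΦ hGz.le hz, gradient_radialFun hm hΦ, smul_smul]
  congr 1
  change _ = (G (radialFun Φ m y z) * ‖z - y‖ ^ m) ^ (p - 1) / ‖z - y‖
  have hmod : 0 < G (radialFun Φ m y z) * ‖z - y‖ ^ m := by positivity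
  rw [Real.rpow_sub_one hr.ne', show p - 2 = p - 1 - 1 by ring, Real.rpow_sub_one hmod.ne']
  have := Real.rpow_pos_of_pos hr m
  field_simp

theorem hasFDerivAt_pGradient_radialFun (hm : 0 < m) (hG : ∀ s, HasDerivAt G (G' s) s)
    (hGpos : ∀ s, 0 < G s) (hΦ : ∀ t, HasDerivAt Φ (G (Φ t)) t) (hx : x ≠ y) {w w' : ℝ}
    (hw : w = radialFlux p m Φ G ‖x - y‖)
    (hw' : w' = (p - 1) * w * (G' (radialFun Φ m y x) * ‖x - y‖ ^ m + m / ‖x - y‖)) :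
    HasFDerivAt (pGradient p (radialFun Φ m y))
      ((w / ‖x - y‖) • 1 + ((w' / ‖x - y‖ - w / ‖x - y‖ ^ 2) / ‖x - y‖) •
        (InnerProductSpace.rankOne ℝ (x - y) (x - y) :
          EuclideanSpace ℝ (Fin n) →L[ℝ] EuclideanSpace ℝ (Fin n))) x := by
  have hxy : x - y ≠ 0 := sub_ne_zero.2 hx
  have hr : 0 < ‖x - y‖ := norm_pos_iff.2 hxy
  have hquot : HasDerivAt (fun r => radialFlux p m Φ G r / r)
      (w' / ‖x - y‖ - w / ‖x - y‖ ^ 2) ‖x - y‖ := by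
    refine ((hasDerivAt_radialFlux hm.le hr hG hGpos hΦ).div (hasDerivAt_id _)
      hr.ne').congr_deriv ?_
    rw [hw', hw, radialFun, id]
    field_simp
  have hfield := hasFDerivAt_radial_smul hxy hquot
  rw [← hw] at hfield
  rw [show pGradient p (radialFun Φ m y) = _ from funext (pGradient_radialFun hm hGpos hΦ)]
  exact hfield.comp x ((hasFDerivAt_id x).sub_const y)

theorem isEigenvalueVector_pHessian_radialFun (hm : 0 < m) (hG : ∀ s, HasDerivAt G (G' s) s)
    (hGpos : ∀ s, 0 < G s) (hΦ : ∀ t, HasDerivAt Φ (G (Φ t)) t) (hx : x ≠ y) (i₀ : Fin n)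
    {w : ℝ} (hw : w = radialFlux p m Φ G ‖x - y‖) :
    IsEigenvalueVector (pHessian p (radialFun Φ m y) x) (Function.update (fun _ => w / ‖x - y‖) i₀
      ((p - 1) * w * (G' (radialFun Φ m y x) * ‖x - y‖ ^ m + m / ‖x - y‖))) := by
  have hr : 0 < ‖x - y‖ := norm_pos_iff.2 (sub_ne_zero.2 hx)
  have hdot : (x - y).ofLp ⬝ᵥ (x - y).ofLp = ‖x - y‖ ^ 2 := by
    rw [EuclideanSpace.norm_sq_eq]
    simp only [dotProduct, Real.norm_eq_abs, sq_abs, ← sq]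
  rw [pHessian_eq_symm_toEuclideanCLM,
    (hasFDerivAt_pGradient_radialFun hm hG hGpos hΦ hx hw rfl).fderiv,
    symm_toEuclideanCLM_smul_one_add_smul_rankOne]
  convert (isEigenvalueVector_vecMulVec _ (x - y).ofLp i₀).add_scalar (w / ‖x - y‖) using 1
  ext i
  rcases eq_or_ne i i₀ with rfl | hi
  · rw [Function.update_self, Pi.single_eq_same, smul_dotProduct, hdot, smul_eq_mul]
    field_simp
    ring
  · rw [Function.update_of_ne hi, Pi.single_eq_of_ne hi, zero_add]

end Radial

section RadialEigenvalues

variable {n k : ℕ} {a b : ℝ}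

theorem prod_update_const {ι : Type*} [DecidableEq ι] (i₀ : ι) (s : Finset ι) :
    ∏ i ∈ s, Function.update (fun _ => b) i₀ a i =
      if i₀ ∈ s then a * b ^ (s.card - 1) else b ^ s.card := by
  split_ifs with h
  · rw [Finset.prod_update_of_mem h, Finset.prod_const, Finset.card_sdiff_of_subset (by simpa),
      Finset.card_singleton]
  · rw [Finset.prod_update_of_notMem h, Finset.prod_const]

theorem mul_pow_le_elemSymm_update (hk : 1 ≤ k) (hkn : k ≤ n) (i₀ : Fin n) (ha : 0 ≤ a)
    (hb : 0 ≤ b) : a * b ^ (k - 1) ≤ elemSymm k (Function.update (fun _ => b) i₀ a) := by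
  obtain ⟨s, hs, -, hcard⟩ := Finset.exists_subsuperset_card_eq (n := k)
    (Finset.subset_univ ({i₀} : Finset (Fin n))) (by simpa using hk) (by simpa using hkn)
  have hterm := Finset.single_le_sum (f := fun s => ∏ i ∈ s, Function.update (fun _ => b) i₀ a i)
    (fun t _ => by rw [prod_update_const]; split_ifs <;> positivity)
    (Finset.mem_powersetCard.2 ⟨Finset.subset_univ s, hcard⟩)
  rwa [prod_update_const, hcard, if_pos (hs (Finset.mem_singleton_self i₀))] at hterm

theorem elemSymm_update_le (i₀ : Fin n) (ha : 0 ≤ a) (hb : 0 ≤ b) :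
    elemSymm k (Function.update (fun _ => b) i₀ a) ≤ 2 ^ n * (a * b ^ (k - 1) + b ^ k) := by
  have hterm : ∀ s ∈ Finset.powersetCard k (Finset.univ : Finset (Fin n)),
      ∏ i ∈ s, Function.update (fun _ => b) i₀ a i ≤ a * b ^ (k - 1) + b ^ k := fun s hs => by
    rw [prod_update_const, (Finset.mem_powersetCard.1 hs).2]
    split_ifs
    · exact le_add_of_nonneg_right (by positivity)
    · exact le_add_of_nonneg_left (by positivity)
  have hcard : ((Finset.powersetCard k (Finset.univ : Finset (Fin n))).card : ℝ) ≤ 2 ^ n := by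
    rw [Finset.card_powersetCard, Finset.card_univ, Fintype.card_fin]
    exact_mod_cast Nat.choose_le_two_pow n k
  refine (Finset.sum_le_card_nsmul _ _ _ hterm).trans ?_
  rw [nsmul_eq_mul]
  gcongr

theorem mem_gardingCone_of_pos (hkn : k ≤ n) {lam : Fin n → ℝ} (h : ∀ i, 0 < lam i) :
    lam ∈ gardingCone n k := by
  intro j hj
  refine Finset.sum_pos (fun s _ => Finset.prod_pos fun i _ => h i) ?_
  rw [Finset.powersetCard_nonempty, Finset.card_univ, Fintype.card_fin]
  exact (Finset.mem_Icc.1 hj).2.trans hkn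

theorem rpow_sub_one_pow_eq {p β m q s r : ℝ} (hs : 0 < s) (hr : 0 < r)
    (hq : q = k * (p - β - 1)) :
    ((s * r ^ m) ^ (p - 1)) ^ k = ((s * r ^ m) ^ β) ^ k * (s ^ q * r ^ (m * q)) := by
  have hN : 0 < s * r ^ m := by positivity
  rw [Real.rpow_mul hr.le, ← Real.mul_rpow hs.le (by positivity), ← Real.rpow_natCast,
    ← Real.rpow_natCast, ← Real.rpow_mul hN.le, ← Real.rpow_mul hN.le, ← Real.rpow_add hN, hq]
  congr 1
  ring

theorem radial_eigenvalue_mul_pow_eq {p β m q s r : ℝ} (hk : 1 ≤ k) (hs : 0 < s) (hr : 0 < r)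
    (hq : q = k * (p - β - 1)) (c : ℝ) :
    ((p - 1) * (s * r ^ m) ^ (p - 1) * (c * r ^ m + m / r)) *
        ((s * r ^ m) ^ (p - 1) / r) ^ (k - 1) =
      ((s * r ^ m) ^ β) ^ k * (s ^ q * (r ^ (m * q) / r ^ k)) *
        ((p - 1) * (c * r ^ (m + 1) + m)) := by
  have hpow := rpow_sub_one_pow_eq (m := m) hs hr hq
  obtain ⟨l, rfl⟩ : ∃ l, k = l + 1 := ⟨k - 1, by omega⟩
  rw [← mul_div_assoc, mul_div_assoc', ← hpow, Nat.add_sub_cancel, Real.rpow_add_one hr.ne',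
    div_pow]
  field_simp
  ring

end RadialEigenvalues

section KellerOssermanCondition

open Filter Set

theorem eventually_mul_le_one_of_antitoneOn {h : ℝ → ℝ} {c : ℝ}
    (hanti : AntitoneOn h (Ioi c)) (hint : IntegrableOn h (Ioi c)) :
    ∀ᶠ t in atTop, t * h t ≤ 1 := by
  have hlim : Tendsto (fun t => ∫ s in (c + 1)..t, h s) atTop (nhds (∫ s in Ioi (c + 1), h s)) :=
    intervalIntegral_tendsto_integral_Ioi _ (hint.mono_set (Ioi_subset_Ioi (by linarith)))
      tendsto_id
  have hhalf : Tendsto (fun t : ℝ => t / 2) atTop atTop := tendsto_id.atTop_div_const two_pos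
  have hcauchy := hlim.sub (hlim.comp hhalf)
  rw [sub_self] at hcauchy
  filter_upwards [hcauchy.eventually (gt_mem_nhds (show (0 : ℝ) < 1 / 2 by norm_num)),
    eventually_gt_atTop 0, hhalf.eventually (eventually_gt_atTop (c + 1)),
    eventually_gt_atTop (c + 1)] with t hsmall ht0 hct2 hct
  have hii : ∀ {x y : ℝ}, c < x → c < y → IntervalIntegrable h volume x y := fun hx hy =>
    (hint.mono_set fun z hz => (lt_min hx hy).trans_le hz.1).intervalIntegrable
  simp only [Function.comp] at hsmall
  rw [intervalIntegral.integral_interval_sub_left (hii (by linarith) (by linarith))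
    (hii (by linarith) (by linarith))] at hsmall
  have hlower := intervalIntegral.integral_mono_on (μ := volume) (by linarith : t / 2 ≤ t)
    (f := fun _ => h t) intervalIntegrable_const (hii (by linarith) (by linarith))
    (fun s hs => hanti (show c < s by linarith [hs.1]) (show c < t by linarith) hs.2)
  rw [intervalIntegral.integral_const, smul_eq_mul] at hlower
  linarith

theorem tendsto_integral_inv_atTop_of_not_integrableOn {G h : ℝ → ℝ} (hG : Continuous G)
    (hpos : ∀ s, 0 < G s) (a : ℝ) {b K : ℝ} (h0 : ∀ t ∈ Ioi b, 0 ≤ h t)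
    (hle : ∀ t ∈ Ioi b, h t ≤ K * (G t)⁻¹)
    (hmeas : AEStronglyMeasurable h (volume.restrict (Ioi b))) (hnot : ¬ IntegrableOn h (Ioi b)) :
    Tendsto (fun t => ∫ s in a..t, (G s)⁻¹) atTop atTop := by
  have hinv : ∀ s, 0 ≤ (G s)⁻¹ := fun s => (inv_pos.2 (hpos s)).le
  have hii : ∀ x y, IntervalIntegrable (fun r => (G r)⁻¹) volume x y :=
    (hG.inv₀ fun r => (hpos r).ne').intervalIntegrable
  have hmono : Monotone fun t => ∫ s in a..t, (G s)⁻¹ := fun x y hxy => by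
    dsimp only
    rw [← intervalIntegral.integral_add_adjacent_intervals (hii a x) (hii x y)]
    exact le_add_of_nonneg_right (intervalIntegral.integral_nonneg hxy fun s _ => hinv s)
  refine tendsto_atTop_atTop_of_monotone' hmono fun ⟨B, hB⟩ => hnot ?_
  have hGint : IntegrableOn (fun r => (G r)⁻¹) (Ioi b) := by
    refine integrableOn_Ioi_of_intervalIntegral_norm_bounded (B - ∫ s in a..b, (G s)⁻¹) b
      (b := fun t : ℝ => t) (l := atTop) (fun t => (hii b t).1) tendsto_id
      (Eventually.of_forall fun t => ?_)
    simp only [Real.norm_of_nonneg (hinv _)]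
    have hsplit := intervalIntegral.integral_add_adjacent_intervals (hii a b) (hii b t)
    have hbound := hB (mem_range_self t)
    linarith
  refine Integrable.mono' (hGint.const_mul K) hmeas ?_
  refine (ae_restrict_iff' measurableSet_Ioi).2 (Eventually.of_forall fun t ht => ?_)
  rw [Real.norm_of_nonneg (h0 t ht)]
  exact hle t ht

theorem half_mul_le_integral {h : ℝ → ℝ} (hmono : Monotone h) (hnonneg : ∀ s, 0 ≤ h s) {t : ℝ}
    (ht : 0 ≤ t) : t / 2 * h (t / 2) ≤ ∫ s in (0 : ℝ)..t, h s := by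
  have hii : ∀ x y, IntervalIntegrable h volume x y := fun _ _ => hmono.intervalIntegrable
  rw [← intervalIntegral.integral_add_adjacent_intervals (hii 0 (t / 2)) (hii (t / 2) t)]
  have hleft := intervalIntegral.integral_nonneg (μ := volume) (by linarith : 0 ≤ t / 2)
    fun s _ => hnonneg s
  have hright := intervalIntegral.integral_mono_on (μ := volume) (by linarith : t / 2 ≤ t)
    (f := fun _ => h (t / 2)) intervalIntegrable_const (hii _ _) fun s hs => hmono hs.1
  rw [intervalIntegral.integral_const, smul_eq_mul] at hright
  linarith

variable {q κ t y : ℝ}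

theorem rpow_le_of_mul_rpow_neg_le_one (hq : 0 < q) (ht : 0 < t) (hy : 0 < y)
    (h : t * (t * y) ^ (-(1 / (q + 1))) ≤ 1) : t ^ q ≤ y := by
  have hty : 0 < t * y := mul_pos ht hy
  rw [Real.rpow_neg hty.le, ← div_eq_mul_inv, div_le_one (Real.rpow_pos_of_pos hty _)] at h
  have hpow := Real.rpow_le_rpow ht.le h (by positivity : 0 ≤ q + 1)
  rw [← Real.rpow_mul hty.le, one_div_mul_cancel (by positivity), Real.rpow_one,
    Real.rpow_add_one ht.ne', mul_comm] at hpow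
  exact le_of_mul_le_mul_left hpow ht

theorem mul_rpow_rpow_neg_le (hq : 0 < q) (hκ : 1 ≤ κ) (ht : 0 < t) (hy : t ^ q ≤ y) :
    (t * y ^ κ) ^ (-(1 / (κ * q + 1))) ≤ (t * y) ^ (-(1 / (q + 1))) := by
  have hy0 : 0 < y := (Real.rpow_pos_of_pos ht q).trans_le hy
  have hpow : (t * y) ^ (κ * q + 1) ≤ (t * y ^ κ) ^ (q + 1) := by
    rw [Real.mul_rpow ht.le hy0.le, Real.mul_rpow ht.le (by positivity), ← Real.rpow_mul hy0.le,
      show κ * q + 1 = (q + 1) + q * (κ - 1) by ring, Real.rpow_add ht, Real.rpow_mul ht.le,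
      mul_assoc]
    refine mul_le_mul_of_nonneg_left ?_ (by positivity)
    calc (t ^ q) ^ (κ - 1) * y ^ (q + 1 + q * (κ - 1))
        ≤ y ^ (κ - 1) * y ^ (q + 1 + q * (κ - 1)) := by
          refine mul_le_mul_of_nonneg_right ?_ (by positivity)
          exact Real.rpow_le_rpow (by positivity) hy (by linarith)
      _ = y ^ (κ * (q + 1)) := by
          rw [← Real.rpow_add hy0]
          ring_nf
  have hroot := Real.rpow_le_rpow (by positivity) hpow
    (show 0 ≤ 1 / ((q + 1) * (κ * q + 1)) by positivity)
  rw [← Real.rpow_mul (by positivity), ← Real.rpow_mul (by positivity),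
    show (κ * q + 1) * (1 / ((q + 1) * (κ * q + 1))) = 1 / (q + 1) by field_simp,
    show (q + 1) * (1 / ((q + 1) * (κ * q + 1))) = 1 / (κ * q + 1) by field_simp] at hroot
  rw [Real.rpow_neg (by positivity), Real.rpow_neg (by positivity)]
  exact inv_anti₀ (by positivity) hroot

theorem not_integrableOn_of_kellerOsserman {g : ℝ → ℝ} (hmono : Monotone g)
    (hpos : ∀ t, 0 < g t) (hq : 0 < q) (hκ : 1 ≤ κ)
    (hKO : KellerOsserman (fun s => g s ^ κ) (κ * q)) :
    ¬ IntegrableOn (fun t => (t * g t) ^ (-(1 / (q + 1)))) (Ioi 1) := by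
  intro hint
  have hexp : ∀ θ : ℝ, 0 < θ → -(1 / (θ + 1)) ≤ 0 := fun θ hθ =>
    neg_nonpos.2 (by positivity)
  have hanti : AntitoneOn (fun t => (t * g t) ^ (-(1 / (q + 1)))) (Ioi 1) := fun s hs t ht hst =>
    have hs0 : (0 : ℝ) < s := one_pos.trans hs
    Real.rpow_le_rpow_of_nonpos (mul_pos hs0 (hpos s))
      (mul_le_mul hst (hmono hst) (hpos s).le (hs0.le.trans hst)) (hexp q hq)
  obtain ⟨t₀, ht₀⟩ := eventually_atTop.1 (eventually_mul_le_one_of_antitoneOn hanti hint)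
  set c := max t₀ 1
  have hc1 : 1 ≤ c := le_max_right _ _
  have hgrow : ∀ t, c ≤ t → t ^ q ≤ g t := fun t ht =>
    rpow_le_of_mul_rpow_neg_le_one hq (by linarith) (hpos t) (ht₀ t ((le_max_left _ _).trans ht))
  have hscale : IntegrableOn (fun t => ((1 / 2 * t) * g (1 / 2 * t)) ^ (-(1 / (q + 1))))
      (Ioi (2 * c)) := by
    rw [integrableOn_Ioi_comp_mul_left_iff (fun t => (t * g t) ^ (-(1 / (q + 1)))) (2 * c)
      (by norm_num : (0 : ℝ) < 1 / 2)]
    exact hint.mono_set (Ioi_subset_Ioi (by linarith))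
  refine absurd (hKO (2 * c) (by linarith)) (ne_of_lt (lt_of_le_of_lt ?_ hscale.lintegral_lt_top))
  refine setLIntegral_mono' measurableSet_Ioi fun t (ht : 2 * c < t) =>
    ENNReal.ofReal_le_ofReal ?_
  rw [one_div_mul_eq_div]
  have hgt := hpos (t / 2)
  have ht2 : 0 < t / 2 := by linarith
  refine le_trans ?_ (mul_rpow_rpow_neg_le hq hκ ht2 (hgrow _ (by linarith)))
  exact Real.rpow_le_rpow_of_nonpos (by positivity)
    (half_mul_le_integral (fun a b hab => Real.rpow_le_rpow (hpos a).le (hmono hab) (by linarith))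
      (fun s => Real.rpow_nonneg (hpos s).le κ) (by linarith))
    (hexp _ (by positivity))

end KellerOssermanCondition

section GlobalProfile

open Filter

/-- The function `C φ` times a continuous cutoff that vanishes on `(-∞, -1]` and is `1` on
`[0, ∞)`. -/
noncomputable def cutoffSource (C : ℝ) (φ : ℝ → ℝ) (s : ℝ) : ℝ :=
  C * (φ s * max 0 (min 1 (s + 1)))

/-- The primitive of `cutoffSource C φ` with the constant value `A` on `(-∞, -1]`. It plays the role
of the energy `H` in the equation `Φ' = H(Φ)^{1/(q+1)}` of a global radial profile. -/
noncomputable def cutoffEnergy (A C : ℝ) (φ : ℝ → ℝ) (s : ℝ) : ℝ :=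
  A + ∫ r in (-1)..s, cutoffSource C φ r

variable {A C q s t : ℝ} {φ : ℝ → ℝ}

theorem continuous_cutoffSource (hφ : Continuous φ) : Continuous (cutoffSource C φ) := by
  unfold cutoffSource
  fun_prop

theorem cutoffSource_nonneg (hC : 0 ≤ C) (hφ : 0 ≤ φ s) : 0 ≤ cutoffSource C φ s :=
  mul_nonneg hC (mul_nonneg hφ (le_max_left _ _))

theorem cutoffSource_le (hC : 0 ≤ C) (hφ : 0 ≤ φ s) : cutoffSource C φ s ≤ C * φ s :=
  mul_le_mul_of_nonneg_left
    (mul_le_of_le_one_right hφ (max_le zero_le_one (min_le_left _ _))) hC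

theorem cutoffSource_of_le (hs : s ≤ -1) : cutoffSource C φ s = 0 := by
  rw [cutoffSource, max_eq_left ((min_le_right _ _).trans (by linarith)), mul_zero, mul_zero]

theorem cutoffSource_of_nonneg (hs : 0 ≤ s) : cutoffSource C φ s = C * φ s := by
  rw [cutoffSource, min_eq_left (by linarith), max_eq_right zero_le_one, mul_one]

theorem hasDerivAt_cutoffEnergy (hφ : Continuous φ) (s : ℝ) :
    HasDerivAt (cutoffEnergy A C φ) (cutoffSource C φ s) s :=
  (((continuous_cutoffSource hφ).integral_hasStrictDerivAt (-1) s).hasDerivAt).const_add A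

theorem le_cutoffEnergy (hC : 0 ≤ C) (hφ : ∀ s, 0 ≤ φ s) (s : ℝ) : A ≤ cutoffEnergy A C φ s :=
  le_add_of_nonneg_right (integral_nonneg_of_eq_zero_of_le
    (fun s => cutoffSource_nonneg hC (hφ s)) (fun _ => cutoffSource_of_le) s)

theorem cutoffEnergy_pos (hA : 0 < A) (hC : 0 ≤ C) (hφ : ∀ s, 0 < φ s) (s : ℝ) :
    0 < cutoffEnergy A C φ s :=
  hA.trans_le (le_cutoffEnergy hC (fun s => (hφ s).le) s)

theorem continuous_cutoffEnergy (hφ : Continuous φ) : Continuous (cutoffEnergy A C φ) :=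
  continuous_iff_continuousAt.2 fun s => (hasDerivAt_cutoffEnergy hφ s).continuousAt

theorem cutoffEnergy_of_le (hs : s ≤ -1) : cutoffEnergy A C φ s = A := by
  rw [cutoffEnergy, integral_eq_zero_of_le (fun _ => cutoffSource_of_le) hs, add_zero]

theorem cutoffEnergy_le (hA : 0 ≤ A) (hC : 0 ≤ C) (hφ : Continuous φ) (hmono : Monotone φ)
    (hpos : ∀ s, 0 < φ s) (ht : 0 ≤ t) :
    cutoffEnergy A C φ t ≤ (A / φ 0 + C) * ((t + 1) * φ t) := by
  have hint := intervalIntegral.integral_mono_on (μ := volume) (by linarith : (-1 : ℝ) ≤ t)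
    ((continuous_cutoffSource hφ).intervalIntegrable (-1) t) (g := fun _ => C * φ t)
    intervalIntegrable_const (fun s hs => (cutoffSource_le hC (hpos s).le).trans
      (mul_le_mul_of_nonneg_left (hmono hs.2) hC))
  rw [intervalIntegral.integral_const, smul_eq_mul] at hint
  have hφ0 := hpos 0
  have hinitial : A ≤ A / φ 0 * ((t + 1) * φ t) := calc
    A = A / φ 0 * (1 * φ 0) := by field_simp
    _ ≤ A / φ 0 * ((t + 1) * φ t) := by gcongr <;> [linarith; exact hmono ht]
  rw [cutoffEnergy, add_mul]
  linarith

theorem rpow_neg_le_mul_inv_speed_cutoffEnergy (hA : 0 < A) (hC : 0 ≤ C) (hq : 0 < q)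
    (hφ : Continuous φ) (hmono : Monotone φ) (hpos : ∀ s, 0 < φ s) (ht : 1 ≤ t) :
    (t * φ t) ^ (-(1 / (q + 1))) ≤
      (2 * (A / φ 0 + C)) ^ (1 / (q + 1)) * (speed q (cutoffEnergy A C φ) t)⁻¹ := by
  have hφ0 := hpos 0
  have hφt := hpos t
  have hH : 0 < cutoffEnergy A C φ t := cutoffEnergy_pos hA hC hpos t
  rw [Real.rpow_neg (by positivity), ← div_eq_mul_inv, le_div_iff₀ (speed_pos hH),
    inv_mul_le_iff₀ (by positivity), mul_comm, speed,
    ← Real.mul_rpow (by positivity) (by positivity)]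
  refine Real.rpow_le_rpow hH.le ?_ (by positivity)
  calc cutoffEnergy A C φ t ≤ (A / φ 0 + C) * ((t + 1) * φ t) :=
        cutoffEnergy_le hA.le hC hφ hmono hpos (by linarith)
    _ ≤ (A / φ 0 + C) * (2 * t * φ t) := by
        gcongr
        linarith
    _ = 2 * (A / φ 0 + C) * (t * φ t) := by ring

theorem tendsto_integral_inv_speed_cutoffEnergy (hA : 0 < A) (hC : 0 ≤ C) (hq : 0 < q)
    (hφ : Continuous φ) (hmono : Monotone φ) (hpos : ∀ s, 0 < φ s) (a : ℝ)
    (hdiv : ¬ IntegrableOn (fun t => (t * φ t) ^ (-(1 / (q + 1)))) (Set.Ioi 1)) :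
    Tendsto (fun t => ∫ s in a..t, (speed q (cutoffEnergy A C φ) s)⁻¹) atTop atTop := by
  have hH := cutoffEnergy_pos (A := A) hA hC hpos
  have hpos' : ∀ t ∈ Set.Ioi (1 : ℝ), 0 < t * φ t := fun t ht =>
    mul_pos (one_pos.trans ht) (hpos t)
  exact tendsto_integral_inv_atTop_of_not_integrableOn
    (continuous_speed (continuous_cutoffEnergy hφ) hH)
    (fun s => speed_pos (hH s)) a (fun t ht => Real.rpow_nonneg (hpos' t ht).le _)
    (fun t ht => rpow_neg_le_mul_inv_speed_cutoffEnergy hA hC hq hφ hmono hpos (le_of_lt ht))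
    ((ContinuousOn.rpow_const (continuous_id.mul hφ).continuousOn
      fun t ht => Or.inl (hpos' t ht).ne').aestronglyMeasurable measurableSet_Ioi) hdiv

theorem exists_hasDerivAt_comp_self_of_eq_const {G : ℝ → ℝ} {a e : ℝ} (hG : Continuous G)
    (hpos : ∀ s, 0 < G s) (hconst : ∀ s ≤ a, G s = e)
    (htop : Tendsto (fun s => ∫ r in (a - e)..s, (G r)⁻¹) atTop atTop) :
    ∃ Φ : ℝ → ℝ, (∀ t, HasDerivAt Φ (G (Φ t)) t) ∧ StrictMono Φ ∧ Φ 1 = a := by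
  have he : 0 < e := hconst a le_rfl ▸ hpos a
  obtain ⟨Φ, hΦ, hmono, hinv⟩ := exists_hasDerivAt_comp_self hG hpos (a - e)
    (tendsto_integral_inv_atBot_of_le hG hpos fun s hs => (hconst s (by linarith)).le) htop
  have htime : ∫ r in (a - e)..a, (G r)⁻¹ = 1 := by
    rw [intervalIntegral.integral_congr (g := fun _ => e⁻¹), intervalIntegral.integral_const,
      sub_sub_cancel, smul_eq_mul, mul_inv_cancel₀ he.ne']
    intro r hr
    rw [Set.uIcc_of_le (by linarith)] at hr
    simp only [hconst r hr.2]
  exact ⟨Φ, hΦ, hmono, htime ▸ hinv a⟩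

theorem le_speed_rpow_mul_speedDeriv_mul_add {c m X : ℝ} (hc : 0 < c) (hm : 0 < m) (hq : 0 < q)
    (hA : 0 < A) (hφ : Monotone φ) (hpos : ∀ s, 0 < φ s) (hAm : c * (A ^ (q / (q + 1)) * m) = φ 0)
    (hC : C = (q + 1) / c) (hX : 0 ≤ X) (hX1 : 0 < s → 1 ≤ X) :
    φ s ≤ c * (speed q (cutoffEnergy A C φ) s ^ q *
      (speedDeriv q (cutoffEnergy A C φ) (cutoffSource C φ) s * X + m)) := by
  have hC0 : 0 < C := hC ▸ by positivity
  have hAH := le_cutoffEnergy (A := A) hC0.le (fun s => (hpos s).le) s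
  have hH := hA.trans_le hAH
  have hG' := speedDeriv_nonneg hq hH (cutoffSource_nonneg hC0.le (hpos s).le)
  have hGq : A ^ (q / (q + 1)) ≤ speed q (cutoffEnergy A C φ) s ^ q := by
    rw [speed_rpow hH]
    exact Real.rpow_le_rpow hA.le hAH (by positivity)
  have hGq0 := (Real.rpow_pos_of_pos hA (q / (q + 1))).trans_le hGq
  rcases le_or_gt s 0 with hs | hs
  · calc φ s ≤ c * (A ^ (q / (q + 1)) * m) := (hφ hs).trans_eq hAm.symm
      _ ≤ _ := by
        gcongr
        exact le_add_of_nonneg_left (mul_nonneg hG' hX)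
  · have hODE := speed_rpow_mul_speedDeriv (g := cutoffSource C φ) hq hH
    rw [cutoffSource_of_nonneg hs.le] at hODE
    calc φ s = c * (speed q (cutoffEnergy A C φ) s ^ q *
            speedDeriv q (cutoffEnergy A C φ) (cutoffSource C φ) s) := by
          rw [hODE, hC]
          field_simp
      _ ≤ _ := by
        gcongr
        exact (le_mul_of_one_le_right hG' (hX1 hs)).trans (le_add_of_nonneg_right hm.le)

-- The normalization `Φ 1 = -1` ensures that `r ≥ 1` wherever `Φ > 0`.
theorem exists_profile_of_not_integrableOn {c m : ℝ} (hc : 0 < c) (hm : 0 < m) (hq : 0 < q)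
    (hφ : Continuous φ) (hmono : Monotone φ) (hpos : ∀ s, 0 < φ s)
    (hdiv : ¬ IntegrableOn (fun t => (t * φ t) ^ (-(1 / (q + 1)))) (Set.Ioi 1)) :
    ∃ Φ G G' : ℝ → ℝ, (∀ s, HasDerivAt G (G' s) s) ∧ Continuous G' ∧ (∀ s, 0 < G s) ∧
      (∀ s, 0 ≤ G' s) ∧ (∀ t, HasDerivAt Φ (G (Φ t)) t) ∧
      ∀ r, 0 < r → φ (Φ (r ^ (1 + m) / (1 + m))) ≤ c * (G (Φ (r ^ (1 + m) / (1 + m))) ^ q *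
        (G' (Φ (r ^ (1 + m) / (1 + m))) * r ^ (m + 1) + m)) := by
  have hφ0 := hpos 0
  set C : ℝ := (q + 1) / c
  set A : ℝ := (φ 0 / (c * m)) ^ ((q + 1) / q)
  have hC : 0 < C := by positivity
  have hA : 0 < A := by positivity
  have hAm : c * (A ^ (q / (q + 1)) * m) = φ 0 := by
    rw [← Real.rpow_mul (by positivity), div_mul_div_cancel₀ hq.ne', div_self (by positivity),
      Real.rpow_one]
    field_simp
  have hH := cutoffEnergy_pos hA hC.le hpos
  have hHc : Continuous (cutoffEnergy A C φ) := continuous_cutoffEnergy hφ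
  obtain ⟨Φ, hΦ, hΦmono, hΦ1⟩ := exists_hasDerivAt_comp_self_of_eq_const (a := -1)
    (e := A ^ (1 / (q + 1))) (continuous_speed (q := q) hHc hH)
    (fun s => speed_pos (hH s)) (fun s hs => by rw [speed, cutoffEnergy_of_le hs])
    (tendsto_integral_inv_speed_cutoffEnergy hA hC.le hq hφ hmono hpos _ hdiv)
  refine ⟨Φ, speed q (cutoffEnergy A C φ), speedDeriv q (cutoffEnergy A C φ) (cutoffSource C φ),
    fun s => hasDerivAt_speed (hasDerivAt_cutoffEnergy hφ s) (hH s),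
    continuous_speedDeriv hHc (continuous_cutoffSource hφ) hH, fun s => speed_pos (hH s),
    fun s => speedDeriv_nonneg hq (hH s) (cutoffSource_nonneg hC.le (hpos s).le), hΦ,
    fun r hr => le_speed_rpow_mul_speedDeriv_mul_add hc hm hq hA hmono hpos hAm rfl
      (by positivity) fun hs => Real.one_le_rpow ?_ (by linarith)⟩
  by_contra! hr1
  have ht1 : r ^ (1 + m) / (1 + m) < 1 := by
    rw [div_lt_one (by linarith)]
    linarith [Real.rpow_le_one hr.le hr1.le (by linarith : 0 ≤ 1 + m)]
  linarith [hΦmono ht1]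

end GlobalProfile

section Subsolution

open scoped Gradient

variable {n k : ℕ} {p α β m q : ℝ} {f Φ G G' : ℝ → ℝ}

theorem rpow_div_pow_eq {r : ℝ} (hr : 0 < r) (α : ℝ) (k : ℕ) :
    r ^ ((k : ℝ) * (α + 1)) / r ^ k = (r ^ α) ^ k := by
  rw [← Real.rpow_natCast, ← Real.rpow_natCast, ← Real.rpow_mul hr.le, ← Real.rpow_sub hr]
  ring_nf

theorem ofReal_rpow_mul_le_ofReal_rpow_iff {r N y E : ℝ} (hk : k ≠ 0) (hr : 0 < r) (hN : 0 < N)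
    (hy : 0 ≤ y) (hE : 0 ≤ E) :
    ENNReal.ofReal r ^ α * ENNReal.ofReal N ^ β * ENNReal.ofReal y ≤
      ENNReal.ofReal (E ^ (1 / (k : ℝ))) ↔ (r ^ α * N ^ β) ^ k * y ^ k ≤ E := by
  rw [ENNReal.ofReal_rpow_of_pos hr, ENNReal.ofReal_rpow_of_pos hN,
    ← ENNReal.ofReal_mul (by positivity), ← ENNReal.ofReal_mul (by positivity),
    ENNReal.ofReal_le_ofReal_iff (by positivity), one_div,
    Real.le_rpow_inv_iff_of_pos (by positivity) hE (by positivity), Real.rpow_natCast, mul_pow]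

theorem mul_pow_le_radial_eigenvalue_mul_pow {r s c y : ℝ} (hk : 1 ≤ k) (hs : 0 < s) (hr : 0 < r)
    (hq : q = k * (p - β - 1)) (hmq : m * q = k * (α + 1))
    (hineq : y ≤ (p - 1) * (s ^ q * (c * r ^ (m + 1) + m))) :
    (r ^ α * (s * r ^ m) ^ β) ^ k * y ≤
      ((p - 1) * (s * r ^ m) ^ (p - 1) * (c * r ^ m + m / r)) *
        ((s * r ^ m) ^ (p - 1) / r) ^ (k - 1) := by
  rw [radial_eigenvalue_mul_pow_eq hk hs hr hq, hmq, rpow_div_pow_eq hr, mul_pow]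
  calc (r ^ α) ^ k * ((s * r ^ m) ^ β) ^ k * y ≤ (r ^ α) ^ k * ((s * r ^ m) ^ β) ^ k *
        ((p - 1) * (s ^ q * (c * r ^ (m + 1) + m))) := by gcongr
    _ = _ := by ring

theorem isAdmissibleSubsolutionAt_radialFun (hk : 1 ≤ k) (hkn : k ≤ n) (hp : 1 < p) (hm : 0 < m)
    (hq : q = k * (p - β - 1)) (hmq : m * q = k * (α + 1)) (hf : ∀ t, 0 ≤ f t)
    (hG : ∀ s, HasDerivAt G (G' s) s) (hGpos : ∀ s, 0 < G s) (hG'0 : ∀ s, 0 ≤ G' s)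
    (hΦ : ∀ t, HasDerivAt Φ (G (Φ t)) t) {x : EuclideanSpace ℝ (Fin n)} (hx : x ≠ 0)
    (hineq : f (radialFun Φ m 0 x) ^ k ≤ (p - 1) * (G (radialFun Φ m 0 x) ^ q *
      (G' (radialFun Φ m 0 x) * ‖x‖ ^ (m + 1) + m))) :
    IsAdmissibleSubsolutionAt k p α β f (radialFun Φ m 0) x := by
  let i₀ : Fin n := ⟨0, by omega⟩
  have hr : 0 < ‖x‖ := norm_pos_iff.2 hx
  have hs := hGpos (radialFun Φ m 0 x)
  have hc := hG'0 (radialFun Φ m 0 x)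
  have hN := norm_gradient_radialFun hm hΦ hs.le hx
  have hw := norm_gradient_radialFun_rpow (p := p) hm hΦ hs.le hx
  have heig := isEigenvalueVector_pHessian_radialFun hm hG hGpos hΦ hx i₀ hw
  rw [hN, sub_zero] at heig
  have : 0 < p - 1 := by linarith
  refine ⟨(hasFDerivAt_pGradient_radialFun hm hG hGpos hΦ hx hw rfl).differentiableAt, _, heig,
    mem_gardingCone_of_pos hkn fun i => ?_, ?_⟩
  · rw [Function.update_apply]
    split_ifs <;> positivity
  have helem := (mul_pow_le_radial_eigenvalue_mul_pow hk hs hr hq hmq hineq).trans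
    (mul_pow_le_elemSymm_update hk hkn i₀ (by positivity) (by positivity))
  rw [hN, sub_zero, ofReal_rpow_mul_le_ofReal_rpow_iff (by omega) hr (by positivity) (hf _)
    (le_trans (mul_nonneg (by positivity) (pow_nonneg (hf _) k)) helem)]
  exact helem

theorem isEntireSubsolution_radialFun (hn : 0 < n) (hm : 0 < m) (hG : ∀ s, HasDerivAt G (G' s) s)
    (hG' : Continuous G') (hGpos : ∀ s, 0 < G s) (hΦ : ∀ t, HasDerivAt Φ (G (Φ t)) t)
    (hsub : ∀ x : EuclideanSpace ℝ (Fin n), x ≠ 0 →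
      IsAdmissibleSubsolutionAt k p α β f (radialFun Φ m 0) x) :
    IsEntireSubsolution k p α β f (radialFun Φ m (0 : EuclideanSpace ℝ (Fin n))) := by
  have hΦ2 := contDiff_two_of_hasDerivAt_comp_self hG hG' hΦ
  refine ⟨contDiff_radialFun (hΦ2.of_le (by norm_num)) (contDiff_norm_rpow (by linarith)),
    fun x hx => (contDiffAt_radialFun hΦ2 hx).contDiffWithinAt, ?_, hsub⟩
  rintro ⟨c, hc⟩
  let x : EuclideanSpace ℝ (Fin n) := EuclideanSpace.single ⟨0, hn⟩ 1
  have hx : x ≠ 0 := norm_ne_zero_iff.1 (by simp [x])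
  have hgrad := norm_gradient_radialFun hm hΦ (hGpos _).le hx
  rw [show radialFun Φ m 0 = fun _ => c from funext hc, gradient_fun_const, norm_zero] at hgrad
  have hx0 : 0 < ‖x - 0‖ := norm_pos_iff.2 (sub_ne_zero.2 hx)
  have := hGpos c
  exact absurd hgrad (by positivity)

theorem exists_isEntireSubsolution_radialFun (hk : 1 ≤ k) (hkn : k ≤ n) (hp : 1 < p)
    (hα : -1 < α) (hβ : β < p - 1) (hf_cont : Continuous f) (hf_mono : Monotone f)
    (hf_pos : ∀ t, 0 < f t) {κ : ℝ} (hκ : 1 ≤ κ)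
    (hKO : KellerOsserman (fun s => f s ^ (κ * k)) (κ * k * (p - β - 1)))
    (hmdef : m = (α + 1) / (p - β - 1)) :
    ∃ Φ : ℝ → ℝ, ContDiff ℝ 2 Φ ∧
      IsEntireSubsolution k p α β f (radialFun Φ m (0 : EuclideanSpace ℝ (Fin n))) := by
  have : (0 : ℝ) < k := by exact_mod_cast hk
  have hpβ : 0 < p - β - 1 := by linarith
  have hm : 0 < m := hmdef ▸ div_pos (by linarith) hpβ
  have hmq : m * (k * (p - β - 1)) = k * (α + 1) := by
    rw [hmdef]
    field_simp
  have hmono : Monotone fun s => f s ^ k := fun s t hst =>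
    pow_le_pow_left₀ (hf_pos s).le (hf_mono hst) k
  have hpos : ∀ t, 0 < f t ^ k := fun t => pow_pos (hf_pos t) k
  have hKO' : KellerOsserman (fun s => (f s ^ k) ^ κ) (κ * (k * (p - β - 1))) := by
    rw [← mul_assoc]
    refine (funext fun s => ?_ : (fun s => f s ^ (κ * k)) = fun s => (f s ^ k) ^ κ) ▸ hKO
    rw [← Real.rpow_natCast, ← Real.rpow_mul (hf_pos s).le, mul_comm]
  obtain ⟨Φ, G, G', hG, hG'c, hGpos, hG'0, hΦ, hineq⟩ := exists_profile_of_not_integrableOn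
    (sub_pos.2 hp) hm (by positivity) (hf_cont.pow k) hmono hpos
    (not_integrableOn_of_kellerOsserman hmono hpos (by positivity) hκ hKO')
  refine ⟨Φ, contDiff_two_of_hasDerivAt_comp_self hG hG'c hΦ,
    isEntireSubsolution_radialFun (by omega) hm hG hG'c hGpos hΦ fun x hx =>
      isAdmissibleSubsolutionAt_radialFun hk hkn hp hm rfl hmq (fun t => (hf_pos t).le) hG hGpos
        hG'0 hΦ hx ?_⟩
  simpa only [radialFun, sub_zero, Pi.pow_apply] using hineq ‖x‖ (norm_pos_iff.2 hx)

end Subsolution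

section NormPower

variable {E : Type*} [NormedAddCommGroup E] [InnerProductSpace ℝ E] {s t : ℝ}

theorem hasFDerivAt_norm_rpow_smul (ht : 0 < t) (x : E) :
    HasFDerivAt (fun x : E => ‖x‖ ^ t • x) (‖x‖ ^ t • 1 +
      (t * ‖x‖ ^ (t - 1) / ‖x‖) • (InnerProductSpace.rankOne ℝ x x : E →L[ℝ] E)) x := by
  rcases eq_or_ne x 0 with rfl | hx
  · have hpow : Filter.Tendsto (fun x : E => ‖x‖ ^ t) (nhds 0) (nhds 0) := by
      simpa [Real.zero_rpow ht.ne'] using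
        (continuous_norm.rpow_const fun _ => Or.inr ht.le).tendsto (0 : E)
    have hlittle : (fun x : E => ‖x‖ ^ t • x) =o[nhds 0] fun x : E => (1 : ℝ) • x :=
      ((Asymptotics.isLittleO_one_iff ℝ).2 hpow).smul_isBigO (Asymptotics.isBigO_refl _ _)
    refine .of_isLittleO ?_
    simpa [Real.zero_rpow ht.ne'] using hlittle
  · exact hasFDerivAt_radial_smul hx (Real.hasDerivAt_rpow_const (Or.inl (norm_ne_zero_iff.2 hx)))

theorem norm_fderiv_norm_rpow_smul_le (ht : 0 < t) (x : E) :
    ‖fderiv ℝ (fun x : E => ‖x‖ ^ t • x) x‖ ≤ (1 + t) * ‖x‖ ^ t := by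
  rw [(hasFDerivAt_norm_rpow_smul ht x).fderiv]
  rcases eq_or_ne x 0 with rfl | hx
  · simp [Real.zero_rpow ht.ne']
  have hr : 0 < ‖x‖ := norm_pos_iff.2 hx
  calc _ ≤ ‖x‖ ^ t * 1 + (t * ‖x‖ ^ (t - 1) / ‖x‖) * (‖x‖ * ‖x‖) := by
        refine (norm_add_le _ _).trans (add_le_add ?_ ?_)
        · rw [norm_smul, Real.norm_of_nonneg (by positivity)]
          exact mul_le_mul_of_nonneg_left ContinuousLinearMap.norm_id_le (by positivity)
        · rw [norm_smul, Real.norm_of_nonneg (by positivity), InnerProductSpace.norm_rankOne]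
    _ = (1 + t) * ‖x‖ ^ t := by
        rw [Real.rpow_sub_one hr.ne']
        field_simp

theorem contDiff_one_norm_rpow_smul (ht : 0 ≤ t) : ContDiff ℝ 1 (fun x : E => ‖x‖ ^ t • x) := by
  rcases ht.eq_or_lt with rfl | ht
  · simpa using contDiff_fun_id
  refine contDiff_one_iff_fderiv.2
    ⟨fun x => (hasFDerivAt_norm_rpow_smul ht x).differentiableAt,
      continuous_iff_continuousAt.2 fun x => ?_⟩
  rcases eq_or_ne x 0 with rfl | hx
  · have hzero : fderiv ℝ (fun x : E => ‖x‖ ^ t • x) 0 = 0 := by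
      rw [(hasFDerivAt_norm_rpow_smul ht 0).fderiv]
      simp [Real.zero_rpow ht.ne']
    have hpow : Continuous fun x : E => (1 + t) * ‖x‖ ^ t :=
      continuous_const.mul (continuous_norm.rpow_const fun _ => Or.inr ht.le)
    rw [ContinuousAt, hzero, tendsto_zero_iff_norm_tendsto_zero]
    refine squeeze_zero (fun x => norm_nonneg _) (norm_fderiv_norm_rpow_smul_le ht) ?_
    simpa [Real.zero_rpow ht.ne'] using hpow.tendsto 0
  · have hsmooth : ContDiffAt ℝ 1 (fun x : E => ‖x‖ ^ t • x) x :=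
      ((contDiffAt_norm ℝ hx).rpow_const_of_ne (norm_ne_zero_iff.2 hx)).smul contDiffAt_id
    exact (hsmooth.fderiv_right (m := 0) (by norm_num)).continuousAt

theorem contDiff_two_norm_rpow (hs : 2 ≤ s) : ContDiff ℝ 2 (fun x : E => ‖x‖ ^ s) := by
  have hder : fderiv ℝ (fun x : E => ‖x‖ ^ s) =
      fun x => s • innerSL ℝ (‖x‖ ^ (s - 2) • x) := by
    ext1 x
    rw [fderiv_norm_rpow x (by linarith), map_smul, smul_smul]
  rw [show (2 : ℕ∞ω) = 1 + 1 by norm_num, contDiff_succ_iff_fderiv, hder]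
  refine ⟨fun x => (hasFDerivAt_norm_rpow x (by linarith)).differentiableAt, by simp, ?_⟩
  have hinner : ContDiff ℝ 1 (fun x : E => innerSL ℝ x) :=
    (show E →L[ℝ] E →L[ℝ] ℝ from innerSL ℝ).contDiff
  exact (hinner.comp (contDiff_one_norm_rpow_smul (by linarith))).const_smul s

end NormPower

section LocalIntegrability

open Filter Set

variable {n : ℕ} {σ δ : ℝ} {F c : EuclideanSpace ℝ (Fin n) → ℝ}

theorem memLpLoc_norm_rpow_neg (hn : 1 ≤ n) (hδ : 0 < δ) (hσδ : σ * δ < n) :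
    MemLpLoc δ fun x : EuclideanSpace ℝ (Fin n) => ‖x‖ ^ (-σ) := by
  intro K hK
  have hmeas : Measurable fun x : EuclideanSpace ℝ (Fin n) => ‖x‖ ^ (-σ) := by fun_prop
  rw [← integrable_norm_rpow_iff hmeas.aestronglyMeasurable (by simpa using hδ)
    ENNReal.ofReal_ne_top, ENNReal.toReal_ofReal hδ.le]
  refine LocallyIntegrable.integrableOn_isCompact ?_ hK
  refine locallyIntegrable_of_norm_le_rpow (C := 1) (α := σ * δ) (by simpa using hn)
    (by simpa using hσδ) (Eventually.of_forall fun x => ?_)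
    (hmeas.norm.pow_const δ).aestronglyMeasurable
  rw [Real.norm_of_nonneg (by positivity), Real.norm_of_nonneg (by positivity),
    ← Real.rpow_mul (norm_nonneg x), one_mul, neg_mul]

theorem memLpLoc_of_ae_abs_le_mul (hc : Continuous c) {g : EuclideanSpace ℝ (Fin n) → ℝ}
    (hg : MemLpLoc δ g) (hF : AEStronglyMeasurable F) (h : ∀ᵐ x, |F x| ≤ c x * |g x|) :
    MemLpLoc δ F := by
  intro K hK
  obtain ⟨M, hM⟩ := (hK.image hc).isBounded.bddAbove
  refine (hg K hK).of_le_mul (c := M) hF.restrict ?_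
  filter_upwards [ae_restrict_of_ae h, ae_restrict_mem hK.measurableSet] with x hx hxK
  exact hx.trans (mul_le_mul_of_nonneg_right (hM (mem_image_of_mem c hxK)) (abs_nonneg _))

theorem memLpLoc_of_continuous (hF : Continuous F) : MemLpLoc δ F := by
  intro K hK
  obtain ⟨M, hM⟩ := (hK.image hF.norm).isBounded.bddAbove
  have : IsFiniteMeasure (volume.restrict K) := isFiniteMeasure_restrict.2 hK.measure_ne_top
  exact MemLp.of_bound hF.aestronglyMeasurable M
    (ae_restrict_of_forall_mem hK.measurableSet fun x hx => hM (mem_image_of_mem _ hx))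

theorem locallyIntegrable_of_memLpLoc_one (h : MemLpLoc 1 F) : LocallyIntegrable F := by
  rw [locallyIntegrable_iff]
  intro K hK
  simpa only [ENNReal.ofReal_one, memLp_one_iff_integrable, IntegrableOn] using h K hK

theorem locallyIntegrable_mul_norm_rpow_neg (hn : 1 ≤ n) (hσ : σ < 1) (hc : Continuous c) :
    LocallyIntegrable fun x => c x * ‖x‖ ^ (-σ) := by
  have hσn : σ * 1 < n := by
    have : (1 : ℝ) ≤ n := by exact_mod_cast hn
    linarith
  refine locallyIntegrable_of_memLpLoc_one (memLpLoc_of_ae_abs_le_mul hc.abs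
    (memLpLoc_norm_rpow_neg hn one_pos hσn)
    (hc.measurable.mul (by fun_prop)).aestronglyMeasurable
    (Eventually.of_forall fun x => (abs_mul _ _).le))

end LocalIntegrability

section WeakDerivatives

open Filter Set
open scoped RealInnerProductSpace Gradient Topology

variable {n : ℕ}

theorem integral_mul_fderiv_eq_neg {F φ : EuclideanSpace ℝ (Fin n) → ℝ} (hF : ContDiff ℝ 1 F)
    (hφ : ContDiff ℝ 1 φ) (hcs : HasCompactSupport φ) (v : EuclideanSpace ℝ (Fin n)) :
    ∫ x, F x * fderiv ℝ φ x v = -∫ x, fderiv ℝ F x v * φ x := by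
  have hφ' : Continuous fun x => fderiv ℝ φ x v :=
    (hφ.continuous_fderiv one_ne_zero).clm_apply continuous_const
  have hF' : Continuous fun x => fderiv ℝ F x v :=
    (hF.continuous_fderiv one_ne_zero).clm_apply continuous_const
  refine integral_mul_fderiv_eq_neg_fderiv_mul_of_integrable ?_ ?_ ?_
    (fun x _ => hF.differentiable one_ne_zero x) (fun x _ => hφ.differentiable one_ne_zero x)
  · exact (hF'.mul hφ.continuous).integrable_of_hasCompactSupport hcs.mul_left
  · exact (hF.continuous.mul hφ').integrable_of_hasCompactSupport
      ((hcs.fderiv_apply ℝ v).mul_left)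
  · exact (hF.continuous.mul hφ.continuous).integrable_of_hasCompactSupport hcs.mul_left

theorem hasWeakPartialDeriv_of_contDiff {F : EuclideanSpace ℝ (Fin n) → ℝ} (hF : ContDiff ℝ 1 F)
    (i : Fin n) :
    HasWeakPartialDeriv i F (fun x => fderiv ℝ F x (EuclideanSpace.single i 1)) :=
  ⟨hF.continuous.locallyIntegrable,
    ((hF.continuous_fderiv one_ne_zero).clm_apply continuous_const).locallyIntegrable,
    fun _ hφ hcs => integral_mul_fderiv_eq_neg hF (hφ.of_le (by simp)) hcs _⟩

section DominatedConvergence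

variable {F : ℕ → EuclideanSpace ℝ (Fin n) → ℝ} {G b : EuclideanSpace ℝ (Fin n) → ℝ}

theorem locallyIntegrable_of_tendsto_ae (hF : ∀ l, Continuous (F l)) (hb : LocallyIntegrable b)
    (hbound : ∀ l, ∀ᵐ x, |F l x| ≤ b x) (hlim : ∀ᵐ x, Tendsto (F · x) atTop (𝓝 (G x))) :
    LocallyIntegrable G := by
  refine hb.mono (aestronglyMeasurable_of_tendsto_ae atTop
    (fun l => (hF l).aestronglyMeasurable) hlim) ?_
  filter_upwards [ae_all_iff.2 hbound, hlim] with x hx hx'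
  exact (le_of_tendsto hx'.abs (Eventually.of_forall hx)).trans (le_abs_self _)

theorem tendsto_integral_mul_of_locallyIntegrable (hF : ∀ l, Continuous (F l))
    (hb : LocallyIntegrable b) (hbound : ∀ l, ∀ᵐ x, |F l x| ≤ b x)
    (hlim : ∀ᵐ x, Tendsto (F · x) atTop (𝓝 (G x))) {ψ : EuclideanSpace ℝ (Fin n) → ℝ}
    (hψ : Continuous ψ) (hcs : HasCompactSupport ψ) :
    Tendsto (fun l => ∫ x, F l x * ψ x) atTop (𝓝 (∫ x, G x * ψ x)) := by
  refine tendsto_integral_of_dominated_convergence (fun x => ‖ψ x‖ • b x)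
    (fun l => ((hF l).mul hψ).aestronglyMeasurable)
    (hb.integrable_smul_left_of_hasCompactSupport hψ.norm hcs.norm) (fun l => ?_) ?_
  · filter_upwards [hbound l] with x hx
    rw [norm_mul, mul_comm]
    exact mul_le_mul_of_nonneg_left hx (norm_nonneg _)
  · filter_upwards [hlim] with x hx
    exact hx.mul_const _

theorem hasWeakPartialDeriv_of_tendsto_ae {u g b' : EuclideanSpace ℝ (Fin n) → ℝ} {j : Fin n}
    (hF : ∀ l, ContDiff ℝ 1 (F l)) (hb : LocallyIntegrable b) (hb' : LocallyIntegrable b')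
    (hbound : ∀ l, ∀ᵐ x, |F l x| ≤ b x)
    (hbound' : ∀ l, ∀ᵐ x, |fderiv ℝ (F l) x (EuclideanSpace.single j 1)| ≤ b' x)
    (hlim : ∀ᵐ x, Tendsto (F · x) atTop (𝓝 (u x)))
    (hlim' : ∀ᵐ x, Tendsto (fun l => fderiv ℝ (F l) x (EuclideanSpace.single j 1)) atTop
      (𝓝 (g x))) :
    HasWeakPartialDeriv j u g := by
  have hFc := fun l => (hF l).continuous
  have hFc' : ∀ l, Continuous fun x => fderiv ℝ (F l) x (EuclideanSpace.single j 1) := fun l =>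
    ((hF l).continuous_fderiv one_ne_zero).clm_apply continuous_const
  refine ⟨locallyIntegrable_of_tendsto_ae hFc hb hbound hlim,
    locallyIntegrable_of_tendsto_ae hFc' hb' hbound' hlim', fun φ hφ hcs => ?_⟩
  have hφ' : Continuous fun x => fderiv ℝ φ x (EuclideanSpace.single j 1) :=
    (hφ.continuous_fderiv (by simp)).clm_apply continuous_const
  refine tendsto_nhds_unique (tendsto_integral_mul_of_locallyIntegrable hFc hb hbound hlim hφ'
    (hcs.fderiv_apply ℝ _)) (Tendsto.congr (fun l => ?_)
      (tendsto_integral_mul_of_locallyIntegrable hFc' hb' hbound' hlim' hφ.continuous hcs).neg)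
  exact (integral_mul_fderiv_eq_neg (hF l) (hφ.of_le (by simp)) hcs _).symm

end DominatedConvergence

end WeakDerivatives

section Regularization

open Filter Set
open scoped RealInnerProductSpace Gradient Topology

/-- The coordinate `(|x|² + t)^{-σ/2} x_i` of the regularization of the field `|x|^{-σ} x`, which is
smooth for `t > 0`; the field itself is the case `t = 0`. -/
noncomputable def regPow {n : ℕ} (σ : ℝ) (i : Fin n) (t : ℝ) (x : EuclideanSpace ℝ (Fin n)) : ℝ :=
  (‖x‖ ^ 2 + t) ^ (-σ / 2) * x i

variable {n : ℕ} {σ t : ℝ} {i : Fin n} {x v : EuclideanSpace ℝ (Fin n)}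
  {a : EuclideanSpace ℝ (Fin n) → ℝ}

theorem contDiffAt_regPow (hpos : 0 < ‖x‖ ^ 2 + t) : ContDiffAt ℝ 1 (regPow σ i t) x :=
  (((contDiff_norm_sq ℝ).add contDiff_const).contDiffAt.rpow_const_of_ne hpos.ne').mul
    (EuclideanSpace.proj (𝕜 := ℝ) i).contDiff.contDiffAt

theorem fderiv_regPow_apply (hpos : 0 < ‖x‖ ^ 2 + t) (v : EuclideanSpace ℝ (Fin n)) :
    fderiv ℝ (regPow σ i t) x v = (‖x‖ ^ 2 + t) ^ (-σ / 2) * v i -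
      (‖x‖ ^ 2 + t) ^ (-σ / 2 - 1) * (σ * ⟪x, v⟫) * x i := by
  have hsq : HasFDerivAt (fun x : EuclideanSpace ℝ (Fin n) => ‖x‖ ^ 2 + t) (2 • innerSL ℝ x) x :=
    (hasStrictFDerivAt_norm_sq x).hasFDerivAt.add_const t
  have hprod : HasFDerivAt (regPow σ i t) _ x := (hsq.rpow_const (p := -σ / 2)
    (Or.inl hpos.ne')).mul (EuclideanSpace.proj (𝕜 := ℝ) i).hasFDerivAt
  rw [hprod.fderiv]
  simp
  ring

theorem sq_rpow_neg_half (σ : ℝ) (x : EuclideanSpace ℝ (Fin n)) :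
    (‖x‖ ^ 2) ^ (-σ / 2) = ‖x‖ ^ (-σ) := by
  rw [← Real.rpow_natCast, ← Real.rpow_mul (norm_nonneg x), Nat.cast_ofNat, mul_div_cancel₀]
  exact two_ne_zero

theorem sq_add_rpow_neg_half_le (hσ : 0 ≤ σ) (ht : 0 ≤ t) (hx : x ≠ 0) :
    (‖x‖ ^ 2 + t) ^ (-σ / 2) ≤ ‖x‖ ^ (-σ) := by
  rw [← sq_rpow_neg_half]
  have : 0 < ‖x‖ := norm_pos_iff.2 hx
  exact Real.rpow_le_rpow_of_nonpos (by positivity) (by linarith) (by linarith)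

theorem abs_regPow_le (hσ : 0 ≤ σ) (ht : 0 ≤ t) (hx : x ≠ 0) :
    |regPow σ i t x| ≤ ‖x‖ * ‖x‖ ^ (-σ) := by
  rw [regPow, abs_mul, abs_of_nonneg (by positivity), mul_comm]
  exact mul_le_mul (PiLp.norm_apply_le x i) (sq_add_rpow_neg_half_le hσ ht hx) (by positivity)
    (by positivity)

theorem abs_fderiv_regPow_apply_le (hσ : 0 ≤ σ) (ht : 0 ≤ t) (hx : x ≠ 0) (hv : ‖v‖ ≤ 1) :
    |fderiv ℝ (regPow σ i t) x v| ≤ (1 + σ) * ‖x‖ ^ (-σ) := by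
  have hr : 0 < ‖x‖ := norm_pos_iff.2 hx
  have hpos : 0 < ‖x‖ ^ 2 + t := by positivity
  have hle := sq_add_rpow_neg_half_le hσ ht hx
  have hinner : |⟪x, v⟫| ≤ ‖x‖ :=
    (abs_real_inner_le_norm x v).trans (mul_le_of_le_one_right hr.le hv)
  have hfirst : |(‖x‖ ^ 2 + t) ^ (-σ / 2) * v i| ≤ ‖x‖ ^ (-σ) := by
    rw [abs_mul, abs_of_nonneg (by positivity)]
    exact (mul_le_of_le_one_right (by positivity) ((PiLp.norm_apply_le v i).trans hv)).trans hle
  have hsecond : |(‖x‖ ^ 2 + t) ^ (-σ / 2 - 1) * (σ * ⟪x, v⟫) * x i| ≤ σ * ‖x‖ ^ (-σ) := by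
    rw [abs_mul, abs_mul, abs_mul, abs_of_nonneg (by positivity), abs_of_nonneg hσ]
    calc _ ≤ (‖x‖ ^ 2 + t) ^ (-σ / 2 - 1) * (σ * ‖x‖) * ‖x‖ := by
          gcongr
          exact PiLp.norm_apply_le x i
      _ = σ * ((‖x‖ ^ 2 + t) ^ (-σ / 2) * (‖x‖ ^ 2 / (‖x‖ ^ 2 + t))) := by
          rw [Real.rpow_sub_one hpos.ne']
          field_simp
      _ ≤ σ * (‖x‖ ^ (-σ) * 1) := by
          gcongr
          exact (div_le_one hpos).2 (by linarith)
      _ = σ * ‖x‖ ^ (-σ) := by rw [mul_one]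
  rw [fderiv_regPow_apply hpos, add_mul, one_mul]
  exact (abs_sub _ _).trans (add_le_add hfirst hsecond)

theorem abs_mul_regPow_le (hσ : 0 ≤ σ) (ht : 0 ≤ t) (hx : x ≠ 0) :
    |a x * regPow σ i t x| ≤ |a x| * ‖x‖ * ‖x‖ ^ (-σ) := by
  rw [abs_mul, mul_assoc]
  exact mul_le_mul_of_nonneg_left (abs_regPow_le hσ ht hx) (abs_nonneg _)

theorem fderiv_mul_regPow_apply (ha : DifferentiableAt ℝ a x) (hpos : 0 < ‖x‖ ^ 2 + t) :
    fderiv ℝ (fun x => a x * regPow σ i t x) x v =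
      a x * fderiv ℝ (regPow σ i t) x v + fderiv ℝ a x v * regPow σ i t x := by
  rw [fderiv_fun_mul ha ((contDiffAt_regPow hpos).differentiableAt one_ne_zero)]
  simp [mul_comm (regPow σ i t x)]

theorem abs_fderiv_mul_regPow_apply_le (hσ : 0 ≤ σ) (ha : DifferentiableAt ℝ a x) (ht : 0 ≤ t)
    (hx : x ≠ 0) (hv : ‖v‖ ≤ 1) :
    |fderiv ℝ (fun x => a x * regPow σ i t x) x v| ≤
      (|a x| * (1 + σ) + |fderiv ℝ a x v| * ‖x‖) * ‖x‖ ^ (-σ) := by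
  have : 0 < ‖x‖ := norm_pos_iff.2 hx
  rw [fderiv_mul_regPow_apply ha (by positivity)]
  refine (abs_add_le _ _).trans ?_
  rw [abs_mul, abs_mul, add_mul, mul_assoc, mul_assoc]
  gcongr
  exacts [abs_fderiv_regPow_apply_le hσ ht hx hv, abs_regPow_le hσ ht hx]

theorem tendsto_regPow (hx : x ≠ 0) :
    Tendsto (fun t => regPow σ i t x) (𝓝[≥] 0) (𝓝 (regPow σ i 0 x)) := by
  have hbase : ‖x‖ ^ 2 + 0 ≠ 0 := by simpa using hx
  refine tendsto_nhdsWithin_of_tendsto_nhds ?_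
  exact ((tendsto_const_nhds.add tendsto_id).rpow_const (Or.inl hbase)).mul_const _

theorem tendsto_fderiv_mul_regPow_apply (ha : DifferentiableAt ℝ a x) (hx : x ≠ 0) :
    Tendsto (fun t => fderiv ℝ (fun x => a x * regPow σ i t x) x v) (𝓝[≥] 0)
      (𝓝 (fderiv ℝ (fun x => a x * regPow σ i 0 x) x v)) := by
  have : 0 < ‖x‖ := norm_pos_iff.2 hx
  have hpow : ∀ b : ℝ, Tendsto (fun t => (‖x‖ ^ 2 + t) ^ b) (𝓝[≥] 0) (𝓝 ((‖x‖ ^ 2 + 0) ^ b)) :=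
    fun b => tendsto_nhdsWithin_of_tendsto_nhds
      ((tendsto_const_nhds.add tendsto_id).rpow_const (Or.inl (by positivity)))
  have hformula : ∀ t, 0 ≤ t → fderiv ℝ (fun x => a x * regPow σ i t x) x v =
      a x * ((‖x‖ ^ 2 + t) ^ (-σ / 2) * v i - (‖x‖ ^ 2 + t) ^ (-σ / 2 - 1) * (σ * ⟪x, v⟫) * x i) +
        fderiv ℝ a x v * regPow σ i t x := fun t ht => by
    rw [fderiv_mul_regPow_apply ha (by positivity), fderiv_regPow_apply (by positivity)]
  rw [hformula 0 le_rfl]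
  refine Tendsto.congr' (eventually_nhdsWithin_of_forall fun t ht => (hformula t ht).symm) ?_
  exact ((((hpow _).mul_const _).sub (((hpow _).mul_const _).mul_const _)).const_mul _).add
    ((tendsto_regPow hx).const_mul _)

theorem ae_ne_zero (hn : 1 ≤ n) : ∀ᵐ x : EuclideanSpace ℝ (Fin n), x ≠ 0 := by
  have : Nonempty (Fin n) := ⟨⟨0, hn⟩⟩
  exact Measure.ae_ne volume 0

theorem hasWeakPartialDeriv_mul_regPow (hn : 1 ≤ n) (hσ : 0 ≤ σ) (hσ1 : σ < 1)
    (ha : ContDiff ℝ 1 a) (i j : Fin n) :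
    HasWeakPartialDeriv j (fun x => a x * regPow σ i 0 x)
      (fun x => fderiv ℝ (fun x => a x * regPow σ i 0 x) x (EuclideanSpace.single j 1)) := by
  have hda : Differentiable ℝ a := ha.differentiable one_ne_zero
  have hbound : Continuous fun x => |a x| * (1 + σ) +
      |fderiv ℝ a x (EuclideanSpace.single j 1)| * ‖x‖ :=
    (ha.continuous.abs.mul continuous_const).add
      (((ha.continuous_fderiv one_ne_zero).clm_apply continuous_const).abs.mul continuous_norm)
  have hε : ∀ l : ℕ, 0 < 1 / ((l : ℝ) + 1) := fun l => by positivity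
  have hεlim : Tendsto (fun l : ℕ => 1 / ((l : ℝ) + 1)) atTop (𝓝[≥] 0) :=
    tendsto_nhdsWithin_iff.2 ⟨tendsto_one_div_add_atTop_nhds_zero_nat,
      Eventually.of_forall fun l => (hε l).le⟩
  refine hasWeakPartialDeriv_of_tendsto_ae
    (F := fun l x => a x * regPow σ i (1 / ((l : ℝ) + 1)) x)
    (fun l => ha.mul (contDiff_iff_contDiffAt.2 fun x =>
      contDiffAt_regPow (add_pos_of_nonneg_of_pos (sq_nonneg _) (hε l))))
    (locallyIntegrable_mul_norm_rpow_neg hn hσ1 (ha.continuous.abs.mul continuous_norm))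
    (locallyIntegrable_mul_norm_rpow_neg hn hσ1 hbound) (fun l => ?_) (fun l => ?_) ?_ ?_
  all_goals filter_upwards [ae_ne_zero hn] with x hx
  · exact abs_mul_regPow_le hσ (hε l).le hx
  · exact abs_fderiv_mul_regPow_apply_le hσ (hda x) (hε l).le hx (by simp)
  · exact ((tendsto_regPow hx).comp hεlim).const_mul _
  · exact (tendsto_fderiv_mul_regPow_apply (hda x) hx).comp hεlim

theorem memLpLoc_fderiv_mul_regPow_apply (hn : 1 ≤ n) (hσ : 0 ≤ σ) (hσ1 : σ < 1)
    (ha : ContDiff ℝ 1 a) (i j : Fin n) {δ : ℝ} (hδ : 0 < δ) (hσδ : σ * δ < n) :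
    MemLpLoc δ fun x =>
      fderiv ℝ (fun x => a x * regPow σ i 0 x) x (EuclideanSpace.single j 1) := by
  have hbound : Continuous fun x => |a x| * (1 + σ) +
      |fderiv ℝ a x (EuclideanSpace.single j 1)| * ‖x‖ :=
    (ha.continuous.abs.mul continuous_const).add
      (((ha.continuous_fderiv one_ne_zero).clm_apply continuous_const).abs.mul continuous_norm)
  refine memLpLoc_of_ae_abs_le_mul hbound (memLpLoc_norm_rpow_neg hn hδ hσδ)
    (hasWeakPartialDeriv_mul_regPow hn hσ hσ1 ha i j).2.1.aestronglyMeasurable ?_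
  filter_upwards [ae_ne_zero hn] with x hx
  rw [abs_of_nonneg (by positivity : 0 ≤ ‖x‖ ^ (-σ))]
  exact abs_fderiv_mul_regPow_apply_le hσ (ha.differentiable one_ne_zero x) le_rfl hx (by simp)

end Regularization

section RadialRegularity

variable {n : ℕ} {m : ℝ} {Φ : ℝ → ℝ}

theorem fderiv_radialFun_apply_single (hm : 0 < m) (hΦ : Differentiable ℝ Φ) (i : Fin n)
    (x : EuclideanSpace ℝ (Fin n)) :
    fderiv ℝ (radialFun Φ m 0) x (EuclideanSpace.single i 1) =
      radialFun (deriv Φ) m 0 x * regPow (1 - m) i 0 x := by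
  rw [← inner_gradient_left, (hasGradientAt_radialFun hm (hΦ _).hasDerivAt).gradient, sub_zero,
    regPow, add_zero, sq_rpow_neg_half, neg_sub, inner_smul_left,
    EuclideanSpace.inner_single_right]
  simp [radialFun, mul_assoc]

theorem memW2Loc_radialFun (hn : 1 ≤ n) (hm : 0 < m) (hm1 : m ≤ 1) (hΦ : ContDiff ℝ 2 Φ) {δ : ℝ}
    (hδ : 0 < δ) (hmδ : (1 - m) * δ < n) :
    MemW2Loc δ (radialFun Φ m (0 : EuclideanSpace ℝ (Fin n))) := by
  have hnorm : ContDiff ℝ 1 fun z : EuclideanSpace ℝ (Fin n) => ‖z‖ ^ (1 + m) :=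
    contDiff_norm_rpow (by linarith)
  have hu : ContDiff ℝ 1 (radialFun Φ m (0 : EuclideanSpace ℝ (Fin n))) :=
    contDiff_radialFun (hΦ.of_le (by norm_num)) hnorm
  have ha : ContDiff ℝ 1 (radialFun (deriv Φ) m (0 : EuclideanSpace ℝ (Fin n))) :=
    contDiff_radialFun (ContDiff.deriv' (n := 1) hΦ) hnorm
  have hpartial : ∀ i : Fin n, (fun x => fderiv ℝ (radialFun Φ m (0 : EuclideanSpace ℝ (Fin n))) x
      (EuclideanSpace.single i 1)) = fun x => radialFun (deriv Φ) m 0 x * regPow (1 - m) i 0 x :=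
    fun i => funext (fderiv_radialFun_apply_single hm (hΦ.differentiable two_ne_zero) i)
  refine ⟨memLpLoc_of_continuous hu.continuous, _,
    fun i j x => fderiv ℝ (fun x => radialFun (deriv Φ) m 0 x * regPow (1 - m) i 0 x) x
      (EuclideanSpace.single j 1),
    fun i => ⟨hasWeakPartialDeriv_of_contDiff hu i, memLpLoc_of_continuous
      ((hu.continuous_fderiv one_ne_zero).clm_apply continuous_const)⟩, fun i j => ?_⟩
  rw [hpartial i]
  exact ⟨hasWeakPartialDeriv_mul_regPow hn (by linarith) (by linarith) ha i j,
    memLpLoc_fderiv_mul_regPow_apply hn (by linarith) (by linarith) ha i j hδ hmδ⟩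

end RadialRegularity

section MaximumPrinciple

open Filter Metric
open scoped RealInnerProductSpace Gradient Topology

variable {n k : ℕ} {p α β : ℝ} {f : ℝ → ℝ} {u : EuclideanSpace ℝ (Fin n) → ℝ}
  {x y : EuclideanSpace ℝ (Fin n)}

theorem exists_isLocalMax_of_forall_norm_sub_eq_lt {E : Type*} [NormedAddCommGroup E]
    [ProperSpace E] {w : E → ℝ} (hw : Continuous w) {y : E} {ρ : ℝ} (hρ : 0 ≤ ρ)
    (hlt : ∀ x, ‖x - y‖ = ρ → w x < w y) :
    ∃ x, ‖x - y‖ < ρ ∧ w y ≤ w x ∧ IsLocalMax w x := by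
  obtain ⟨x, hx, hmax⟩ := (isCompact_closedBall y ρ).exists_isMaxOn
    ⟨y, mem_closedBall_self hρ⟩ hw.continuousOn
  have hyx : w y ≤ w x := hmax (mem_closedBall_self hρ)
  have hxρ : ‖x - y‖ < ρ :=
    lt_of_le_of_ne (mem_closedBall_iff_norm.1 hx) fun h => (hlt x h).not_ge hyx
  exact ⟨x, hxρ, hyx, hmax.isLocalMax (closedBall_mem_nhds_of_mem (mem_ball_iff_norm.2 hxρ))⟩

theorem elemSymm_zero (hk : k ≠ 0) : elemSymm k (0 : Fin n → ℝ) = 0 := by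
  refine Finset.sum_eq_zero fun s hs => ?_
  simp [(Finset.mem_powersetCard.1 hs).2, hk]

theorem isEigenvalueVector_pHessian_of_eventuallyEq {c : EuclideanSpace ℝ (Fin n)}
    (h : ∇ u =ᶠ[𝓝 x] fun _ => c) : IsEigenvalueVector (pHessian p u x) 0 := by
  have hflux : pGradient p u =ᶠ[𝓝 x] fun _ => ‖c‖ ^ (p - 2) • c :=
    h.fun_comp fun g => ‖g‖ ^ (p - 2) • g
  have hzero : pHessian p u x = 0 := by
    ext i j
    simp [pHessian, hflux.fderiv_eq]
  exact hzero ▸ isEigenvalueVector_zero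

theorem IsEntireSubsolution.contDiffAt_two (hu : IsEntireSubsolution k p α β f u) (hx : x ≠ 0) :
    ContDiffAt ℝ 2 u x :=
  hu.contDiffOn_two.contDiffAt (isOpen_compl_singleton.mem_nhds hx)

theorem IsEntireSubsolution.not_isLocalMax_sub_inner (hu : IsEntireSubsolution k p α β f u)
    (hk : 1 ≤ k) (hp : 1 ≤ p) {a : EuclideanSpace ℝ (Fin n)} (ha : a ≠ 0) (hx : x ≠ 0) :
    ¬ IsLocalMax (fun z => u z - ⟪a, z⟫) x := by
  intro hmax
  have hlin : ContDiff ℝ 2 fun z => ⟪a, z⟫ := contDiff_const.inner ℝ contDiff_id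
  have hgrad : ∇ (fun z => ⟪a, z⟫) = fun _ => a := funext fun z =>
    HasGradientAt.gradient (hasGradientAt_iff_hasFDerivAt.2
      (InnerProductSpace.toDual ℝ _ a).hasFDerivAt)
  have hux : ∇ u x = a := (gradient_eq_of_isLocalMax_sub
    (hu.contDiff_one.differentiable one_ne_zero x) (hlin.differentiable two_ne_zero x) hmax).trans
      (congrFun hgrad x)
  obtain ⟨-, lam, hlam, hcone, -⟩ := hu.subsolution x hx
  have hle := elemSymm_le_of_isLocalMax_sub hp (hu.contDiffAt_two hx) hlin.contDiffAt hmax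
    (hux ▸ ha) hlam (isEigenvalueVector_pHessian_of_eventuallyEq hgrad.eventuallyEq) hcone
  rw [elemSymm_zero (by omega)] at hle
  exact hle.not_gt (hcone k (Finset.mem_Icc.2 ⟨hk, le_rfl⟩))

theorem IsEntireSubsolution.le_of_forall_norm_eq (hu : IsEntireSubsolution k p α β f u)
    (hn : 0 < n) (hk : 1 ≤ k) (hp : 1 ≤ p) {ρ M : ℝ} (hρ : 0 < ρ)
    (hM : ∀ x : EuclideanSpace ℝ (Fin n), ‖x‖ = ρ → u x ≤ M) : u 0 ≤ M := by
  by_contra! hlt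
  have : Nonempty (Fin n) := ⟨⟨0, hn⟩⟩
  -- The equation says nothing at the origin, so the slope of the perturbation avoids `∇ u 0`.
  obtain ⟨a, ha, hane⟩ := (infinite_of_mem_nhds (0 : EuclideanSpace ℝ (Fin n))
    (ball_mem_nhds 0 (div_pos (sub_pos.2 hlt) hρ))).exists_notMem_finite
      (Set.toFinite {0, ∇ u 0})
  rw [mem_ball_zero_iff, lt_div_iff₀ hρ] at ha
  simp only [Set.mem_insert_iff, Set.mem_singleton_iff, not_or] at hane
  have hlin : ContDiff ℝ 1 fun z => ⟪a, z⟫ := contDiff_const.inner ℝ contDiff_id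
  obtain ⟨x, -, -, hmax⟩ := exists_isLocalMax_of_forall_norm_sub_eq_lt (y := 0)
    (w := fun z => u z - ⟪a, z⟫) (hu.contDiff_one.continuous.sub hlin.continuous) hρ.le
    fun x hx => by
      rw [sub_zero] at hx
      have hinner := neg_le_of_abs_le (abs_real_inner_le_norm a x)
      rw [hx] at hinner
      rw [inner_zero_right]
      linarith [hM x hx]
  rcases eq_or_ne x 0 with rfl | hx
  · refine hane.2 (Eq.symm ?_)
    rw [gradient_eq_of_isLocalMax_sub (hu.contDiff_one.differentiable one_ne_zero 0)
      (hlin.differentiable one_ne_zero 0) hmax]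
    exact HasGradientAt.gradient (hasGradientAt_iff_hasFDerivAt.2
      (InnerProductSpace.toDual ℝ _ a).hasFDerivAt)
  · exact hu.not_isLocalMax_sub_inner hk hp hane.1 hx hmax

theorem IsEntireSubsolution.frequently_gradient_ne_zero (hu : IsEntireSubsolution k p α β f u)
    (hk : 1 ≤ k) (hx : x ≠ 0) : ∃ᶠ z in 𝓝 x, ∇ u z ≠ 0 := by
  intro h
  obtain ⟨-, lam, hlam, hcone, -⟩ := hu.subsolution x hx
  have hzero : IsEigenvalueVector (pHessian p u x) 0 :=
    isEigenvalueVector_pHessian_of_eventuallyEq (c := 0) (h.mono fun _ => not_ne_iff.1)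
  have hpos := hcone k (Finset.mem_Icc.2 ⟨hk, le_rfl⟩)
  rw [hlam.elemSymm_eq, ← hzero.elemSymm_eq, elemSymm_zero (by omega)] at hpos
  exact hpos.false

variable {m q : ℝ} {Φ G G' : ℝ → ℝ}

theorem radial_eigenvalue_mul_pow_add_pow_eq {s r : ℝ} (hk : 1 ≤ k) (hs : 0 < s) (hr : 0 < r)
    (hq : q = k * (p - β - 1)) (hmq : m * q = k) (c : ℝ) :
    ((p - 1) * (s * r ^ m) ^ (p - 1) * (c * r ^ m + m / r)) *
        ((s * r ^ m) ^ (p - 1) / r) ^ (k - 1) + ((s * r ^ m) ^ (p - 1) / r) ^ k =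
      ((s * r ^ m) ^ β) ^ k * (((p - 1) * (c * r ^ (m + 1) + m) + 1) * s ^ q) := by
  rw [radial_eigenvalue_mul_pow_eq hk hs hr hq, div_pow, rpow_sub_one_pow_eq hs hr hq, hmq,
    Real.rpow_natCast, div_self (by positivity), mul_div_assoc,
    mul_div_cancel_right₀ _ (by positivity)]
  ring

theorem IsEntireSubsolution.pow_le_of_isLocalMax_sub_radialFun
    (hu : IsEntireSubsolution k p α β f u) (hk : 1 ≤ k) (hp : 1 < p) (hm : 0 < m)
    (hq : q = k * (p - β - 1)) (hmq : m * q = k) (hf_pos : ∀ t, 0 < f t)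
    (hG : ∀ s, HasDerivAt G (G' s) s) (hG' : Continuous G') (hGpos : ∀ s, 0 < G s)
    (hG'0 : ∀ s, 0 ≤ G' s) (hΦ : ∀ t, HasDerivAt Φ (G (Φ t)) t) (hx : x ≠ 0) (hxy : x ≠ y)
    (hmax : IsLocalMax (fun z => u z - radialFun Φ m y z) x) :
    (‖x‖ ^ α * f (u x)) ^ k ≤ 2 ^ n * (((p - 1) *
      (G' (radialFun Φ m y x) * ‖x - y‖ ^ (m + 1) + m) + 1) * G (radialFun Φ m y x) ^ q) := by
  obtain ⟨i₀⟩ : Nonempty (Fin n) := by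
    by_contra h
    rw [not_nonempty_iff] at h
    exact hx (Subsingleton.elim _ _)
  have hr : 0 < ‖x - y‖ := norm_pos_iff.2 (sub_ne_zero.2 hxy)
  have hs := hGpos (radialFun Φ m y x)
  have hc := hG'0 (radialFun Φ m y x)
  have : 0 < p - 1 := sub_pos.2 hp
  have hv := contDiffAt_radialFun (m := m) (contDiff_two_of_hasDerivAt_comp_self hG hG' hΦ) hxy
  have hgrad : ∇ u x = ∇ (radialFun Φ m y) x := gradient_eq_of_isLocalMax_sub
    (hu.contDiff_one.differentiable one_ne_zero x) (hv.differentiableAt two_ne_zero) hmax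
  have hN : ‖∇ u x‖ = G (radialFun Φ m y x) * ‖x - y‖ ^ m :=
    hgrad ▸ norm_gradient_radialFun hm hΦ hs.le hxy
  have hNpos : 0 < ‖∇ u x‖ := by
    rw [hN]
    positivity
  have hN0 : 0 < ((G (radialFun Φ m y x) * ‖x - y‖ ^ m) ^ β) ^ k := by positivity
  obtain ⟨-, lam, hlam, hcone, hsub⟩ := hu.subsolution x hx
  have hcompare := elemSymm_le_of_isLocalMax_sub hp.le (hu.contDiffAt_two hx) hv hmax
    (norm_pos_iff.1 hNpos) hlam (isEigenvalueVector_pHessian_radialFun hm hG hGpos hΦ hxy i₀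
      (w := (G (radialFun Φ m y x) * ‖x - y‖ ^ m) ^ (p - 1)) rfl) hcone
  rw [ofReal_rpow_mul_le_ofReal_rpow_iff (by omega) (norm_pos_iff.2 hx) hNpos (hf_pos _).le
    (hcone k (Finset.mem_Icc.2 ⟨hk, le_rfl⟩)).le] at hsub
  have hupper := hsub.trans (hcompare.trans
    (elemSymm_update_le (k := k) i₀ (by positivity) (by positivity)))
  rw [radial_eigenvalue_mul_pow_add_pow_eq hk hs hr hq hmq, hN] at hupper
  refine le_of_mul_le_mul_left (le_of_eq_of_le ?_ (hupper.trans_eq ?_)) hN0 <;> ring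

end MaximumPrinciple

section Barrier

open Filter Set

variable {F : ℝ → ℝ} {q c M s : ℝ}

theorem exists_integrableOn_of_not_kellerOsserman (hF : Continuous F) (hpos : ∀ t, 0 < F t)
    (hKO : ¬ KellerOsserman F q) :
    ∃ c, 0 < c ∧ IntegrableOn (fun t => (∫ s in (0 : ℝ)..t, F s) ^ (-(1 / (q + 1)))) (Ioi c) := by
  simp only [KellerOsserman, not_forall] at hKO
  obtain ⟨c, hc, hfin⟩ := hKO
  have hprim : ∀ t ∈ Ioi c, 0 < ∫ s in (0 : ℝ)..t, F s := fun t ht =>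
    intervalIntegral.intervalIntegral_pos_of_pos (hF.intervalIntegrable 0 t) hpos (hc.trans ht)
  have hcont : Continuous fun t => ∫ s in (0 : ℝ)..t, F s :=
    intervalIntegral.continuous_primitive hF.intervalIntegrable 0
  refine ⟨c, hc, (hcont.continuousOn.rpow_const fun t ht =>
    Or.inl (hprim t ht).ne').aestronglyMeasurable measurableSet_Ioi, ?_⟩
  rw [hasFiniteIntegral_iff_ofReal ((ae_restrict_iff' measurableSet_Ioi).2
    (Eventually.of_forall fun t ht => Real.rpow_nonneg (hprim t ht).le _))]
  exact lt_top_iff_ne_top.2 hfin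

theorem eventually_rpow_le_of_integrableOn (hF : Continuous F) (hmono : Monotone F)
    (hpos : ∀ t, 0 < F t) (hq : 0 < q) (hc : 0 ≤ c)
    (hint : IntegrableOn (fun t => (∫ s in (0 : ℝ)..t, F s) ^ (-(1 / (q + 1)))) (Ioi c)) :
    ∀ᶠ t in atTop, t ^ q ≤ F t := by
  have hexp : -(1 / (q + 1)) ≤ 0 := neg_nonpos.2 (by positivity)
  have hprim : ∀ t, 0 < t → 0 < ∫ s in (0 : ℝ)..t, F s := fun t ht =>
    intervalIntegral.intervalIntegral_pos_of_pos (hF.intervalIntegrable 0 t) hpos ht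
  have hanti : AntitoneOn (fun t => (∫ s in (0 : ℝ)..t, F s) ^ (-(1 / (q + 1)))) (Ioi c) :=
    fun s hs t _ hst => Real.rpow_le_rpow_of_nonpos (hprim s (hc.trans_lt hs))
      (intervalIntegral.integral_mono_interval le_rfl (hc.trans (le_of_lt hs)) hst
        (Eventually.of_forall fun r => (hpos r).le) (hF.intervalIntegrable 0 t)) hexp
  filter_upwards [eventually_mul_le_one_of_antitoneOn hanti hint, eventually_gt_atTop 0]
    with t ht ht0
  have hle := intervalIntegral.integral_mono_on (μ := volume) ht0.le
    (hF.intervalIntegrable 0 t) (g := fun _ => F t) intervalIntegrable_const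
    (fun s hs => hmono hs.2)
  rw [intervalIntegral.integral_const, smul_eq_mul, sub_zero] at hle
  refine rpow_le_of_mul_rpow_neg_le_one hq ht0 (hpos t) (le_trans ?_ ht)
  exact mul_le_mul_of_nonneg_left (Real.rpow_le_rpow_of_nonpos (hprim t ht0) hle hexp) ht0.le

theorem exists_add_one_rpow_le_mul (hmono : Monotone F) (hpos : ∀ t, 0 < F t) (hq : 0 < q)
    (hgrow : ∀ᶠ t in atTop, t ^ q ≤ F t) :
    ∃ B, 0 < B ∧ ∀ s, 0 ≤ s → (s + 1) ^ q ≤ B * F s := by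
  obtain ⟨a, ha⟩ := eventually_atTop.1 (hgrow.and (eventually_ge_atTop 1))
  have ha1 : 1 ≤ a := (ha a le_rfl).2
  have hF0 := hpos 0
  refine ⟨2 ^ q + (a + 1) ^ q / F 0, by positivity, fun s hs => ?_⟩
  have hFs := hpos s
  rw [add_mul]
  rcases le_total s a with h | h
  · calc (s + 1) ^ q ≤ (a + 1) ^ q / F 0 * F 0 := by
          rw [div_mul_cancel₀ _ hF0.ne']
          gcongr
      _ ≤ (a + 1) ^ q / F 0 * F s := by
          gcongr
          exact hmono hs
      _ ≤ _ := le_add_of_nonneg_left (by positivity)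
  · calc (s + 1) ^ q ≤ (2 * s) ^ q := by
          gcongr
          linarith
      _ = 2 ^ q * s ^ q := Real.mul_rpow zero_le_two hs
      _ ≤ 2 ^ q * F s := by
          gcongr
          exact (ha s h).1
      _ ≤ _ := le_add_of_nonneg_right (by positivity)

theorem not_integrableOn_of_le (hpos : ∀ t, 0 < F t) (hq : 0 ≤ q)
    (hM : ∀ t, F t ≤ M) : ¬ IntegrableOn (fun t => (t * F t) ^ (-(1 / (q + 1)))) (Ioi 1) := by
  intro hint
  have : 0 < M := (hpos 0).trans_le (hM 0)
  have hexp : 1 / (q + 1) ≤ 1 := (div_le_one (by positivity)).2 (by linarith)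
  refine absurd (a := (-1 : ℝ) ≤ -(1 / (q + 1))) (neg_le_neg hexp) (not_le.2 ?_)
  rw [← integrableOn_Ioi_rpow_iff one_pos]
  refine Integrable.mono' (hint.const_mul (M ^ (1 / (q + 1))))
    (by fun_prop) ((ae_restrict_iff' measurableSet_Ioi).2 (Eventually.of_forall fun t ht => ?_))
  have ht0 : 0 < t := one_pos.trans ht
  have hFt := hpos t
  rw [Real.norm_of_nonneg (by positivity), Real.mul_rpow ht0.le hFt.le, mul_left_comm]
  refine le_mul_of_one_le_right (by positivity) ?_
  rw [Real.rpow_neg hFt.le, ← div_eq_mul_inv, one_le_div (by positivity)]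
  exact Real.rpow_le_rpow hFt.le (hM t) (by positivity)

theorem integral_inv_le_add_setIntegral {G h : ℝ → ℝ} (hG : Continuous G) (hG1 : ∀ s, 1 ≤ G s)
    (hc : 0 ≤ c) (hcM : c ≤ M) (hint : IntegrableOn h (Ioi c)) (h0 : ∀ t ∈ Ioi c, 0 ≤ h t)
    (hle : ∀ t ∈ Ioc c M, (G t)⁻¹ ≤ h t) :
    ∫ t in (0 : ℝ)..M, (G t)⁻¹ ≤ c + ∫ t in Ioi c, h t := by
  have hinv : Continuous fun t => (G t)⁻¹ := hG.inv₀ fun t => (one_pos.trans_le (hG1 t)).ne'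
  rw [← intervalIntegral.integral_add_adjacent_intervals (hinv.intervalIntegrable 0 c)
    (hinv.intervalIntegrable c M)]
  refine add_le_add ?_ ?_
  · simpa using intervalIntegral.integral_mono_on (μ := volume) hc (hinv.intervalIntegrable 0 c)
      (g := fun _ => 1) intervalIntegrable_const fun t _ => inv_le_one_of_one_le₀ (hG1 t)
  · rw [intervalIntegral.integral_of_le hcM]
    exact (setIntegral_mono_on (hinv.integrableOn_Ioc) (hint.mono_set Ioc_subset_Ioi_self)
      measurableSet_Ioc hle).trans (setIntegral_mono_set hint
        ((ae_restrict_iff' measurableSet_Ioi).2 (Eventually.of_forall h0))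
        (Eventually.of_forall Ioc_subset_Ioi_self))

theorem mul_integral_le_cutoffEnergy {A C : ℝ} (hA : 0 ≤ A) (hC : 0 ≤ C) (hF : Continuous F)
    (hF0 : ∀ t, 0 ≤ F t) (hs : 0 ≤ s) : C * ∫ t in (0 : ℝ)..s, F t ≤ cutoffEnergy A C F s := by
  have hii := (continuous_cutoffSource (C := C) hF).intervalIntegrable (μ := volume)
  rw [cutoffEnergy, ← intervalIntegral.integral_add_adjacent_intervals (hii (-1) 0) (hii 0 s),
    ← add_assoc, ← intervalIntegral.integral_const_mul]
  refine (intervalIntegral.integral_congr fun t ht => ?_).trans_le (le_add_of_nonneg_left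
    (add_nonneg hA (intervalIntegral.integral_nonneg (by norm_num)
      fun t _ => cutoffSource_nonneg hC (hF0 t))))
  rw [Set.uIcc_of_le hs] at ht
  exact (cutoffSource_of_nonneg ht.1).symm

theorem speed_cutoffEnergy_rpow_le {A B C y : ℝ} (hA : 0 < A) (hB : 0 ≤ B) (hC : 0 ≤ C)
    (hq : 0 < q) (hF : Continuous F) (hmono : Monotone F) (hpos : ∀ t, 0 < F t) (hs : 0 ≤ s)
    (hy : F s ≤ y) (hgrow : (s + 1) ^ q ≤ B * y) :
    speed q (cutoffEnergy A C F) s ^ q ≤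
      (A / F 0 + C) ^ (q / (q + 1)) * B ^ (1 / (q + 1)) * y := by
  have hF0 := hpos 0
  have hFs := hpos s
  have hy0 : 0 < y := hFs.trans_le hy
  have hH : 0 < cutoffEnergy A C F s := cutoffEnergy_pos hA hC hpos s
  have hsum : 1 / (q + 1) + q / (q + 1) = 1 := by field_simp; ring
  calc speed q (cutoffEnergy A C F) s ^ q = cutoffEnergy A C F s ^ (q / (q + 1)) := speed_rpow hH
    _ ≤ ((A / F 0 + C) * ((s + 1) * y)) ^ (q / (q + 1)) := by
        refine Real.rpow_le_rpow hH.le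
          ((cutoffEnergy_le hA.le hC hF hmono hpos hs).trans ?_) (by positivity)
        gcongr
    _ = (A / F 0 + C) ^ (q / (q + 1)) * (((s + 1) ^ q) ^ (1 / (q + 1)) * y ^ (q / (q + 1))) := by
        rw [Real.mul_rpow (by positivity) (by positivity), Real.mul_rpow (by positivity) hy0.le,
          ← Real.rpow_mul (by positivity), mul_one_div]
    _ ≤ (A / F 0 + C) ^ (q / (q + 1)) * ((B * y) ^ (1 / (q + 1)) * y ^ (q / (q + 1))) := by
        gcongr
    _ = (A / F 0 + C) ^ (q / (q + 1)) * B ^ (1 / (q + 1)) * y := by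
        rw [Real.mul_rpow hB hy0.le, mul_assoc (B ^ (1 / (q + 1))), ← Real.rpow_add hy0, hsum,
          Real.rpow_one, mul_assoc]

theorem exists_hasDerivAt_speed_cutoffEnergy {A C : ℝ} (hA : 0 < A) (hC : 0 ≤ C) (hq : 0 < q)
    (hF : Continuous F) (hmono : Monotone F) (hpos : ∀ t, 0 < F t) (hM : ∀ t, F t ≤ M) (a : ℝ) :
    ∃ Φ : ℝ → ℝ, (∀ t, HasDerivAt Φ (speed q (cutoffEnergy A C F) (Φ t)) t) ∧ StrictMono Φ ∧
      ∀ s, Φ (∫ r in a..s, (speed q (cutoffEnergy A C F) r)⁻¹) = s := by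
  have hH := cutoffEnergy_pos hA hC hpos
  have hG : Continuous (speed q (cutoffEnergy A C F)) :=
    continuous_speed (continuous_cutoffEnergy hF) hH
  have hHmono : Monotone (cutoffEnergy A C F) :=
    monotone_of_hasDerivAt_nonneg (hasDerivAt_cutoffEnergy hF)
      fun s => cutoffSource_nonneg hC (hpos s).le
  exact exists_hasDerivAt_comp_self hG (fun s => speed_pos (hH s)) a
    (tendsto_integral_inv_atBot_of_le hG (fun s => speed_pos (hH s)) fun s hs =>
      Real.rpow_le_rpow (hH s).le (hHmono hs) (by positivity))
    (tendsto_integral_inv_speed_cutoffEnergy hA hC hq hF hmono hpos a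
      (not_integrableOn_of_le hpos hq.le hM))

theorem integral_inv_speed_cutoffEnergy_le {c M : ℝ} (hF : Continuous F) (hpos : ∀ t, 0 < F t)
    (hq : 0 < q) (hc : 0 ≤ c) (hcM : c ≤ M)
    (hint : IntegrableOn (fun t => (∫ s in (0 : ℝ)..t, F s) ^ (-(1 / (q + 1)))) (Ioi c))
    {φ : ℝ → ℝ} (hφ : Continuous φ) (hφ0 : ∀ t, 0 ≤ φ t) (hφF : ∀ t ≤ M, φ t = F t) :
    ∫ t in (0 : ℝ)..M, (speed q (cutoffEnergy 1 1 φ) t)⁻¹ ≤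
      c + ∫ t in Ioi c, (∫ s in (0 : ℝ)..t, F s) ^ (-(1 / (q + 1))) := by
  have hprim : ∀ t, 0 < t → 0 < ∫ s in (0 : ℝ)..t, F s := fun t ht =>
    intervalIntegral.intervalIntegral_pos_of_pos (hF.intervalIntegrable 0 t) hpos ht
  have hH : ∀ s, 1 ≤ cutoffEnergy 1 1 φ s := le_cutoffEnergy zero_le_one hφ0
  refine integral_inv_le_add_setIntegral
    (continuous_speed (continuous_cutoffEnergy hφ) fun s => one_pos.trans_le (hH s))
    (fun s => Real.one_le_rpow (hH s) (by positivity)) hc hcM hint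
    (fun t ht => Real.rpow_nonneg (hprim t (hc.trans_lt ht)).le _) fun t ht => ?_
  have ht0 : 0 < t := hc.trans_lt ht.1
  have hle := mul_integral_le_cutoffEnergy zero_le_one zero_le_one hφ hφ0 ht0.le
  rw [one_mul, intervalIntegral.integral_congr (g := F) fun s hs => hφF s
    ((uIcc_of_le ht0.le ▸ hs).2.trans ht.2)] at hle
  have hP := hprim t ht0
  rw [Real.rpow_neg hP.le]
  exact inv_anti₀ (by positivity) (Real.rpow_le_rpow hP.le hle (by positivity))

-- Capping `F` at a height `M` produces a global profile; the time it needs to reach `M` is bounded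
-- by the convergent Keller–Osserman integral of `F`, uniformly in `M`.
theorem exists_barrier_of_not_kellerOsserman (hF : Continuous F) (hmono : Monotone F)
    (hpos : ∀ t, 0 < F t) (hq : 0 < q) (hKO : ¬ KellerOsserman F q) :
    ∃ B T : ℝ, 0 < T ∧ ∀ M₀ : ℝ, ∃ Φ G G' : ℝ → ℝ,
      (∀ s, HasDerivAt G (G' s) s) ∧ Continuous G' ∧ (∀ s, 0 < G s) ∧ (∀ s, 0 ≤ G' s) ∧
      (∀ t, HasDerivAt Φ (G (Φ t)) t) ∧ StrictMono Φ ∧ Φ 0 = 0 ∧ M₀ ≤ Φ T ∧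
      ∀ s, 0 ≤ s → G s ^ q ≤ B * F s ∧ G s ^ q * G' s ≤ F s / (q + 1) := by
  obtain ⟨c, hc, hint⟩ := exists_integrableOn_of_not_kellerOsserman hF hpos hKO
  obtain ⟨B, hB, hgrow⟩ := exists_add_one_rpow_le_mul hmono hpos hq
    (eventually_rpow_le_of_integrableOn hF hmono hpos hq hc.le hint)
  refine ⟨(1 / F 0 + 1) ^ (q / (q + 1)) * B ^ (1 / (q + 1)),
    c + ∫ t in Ioi c, (∫ s in (0 : ℝ)..t, F s) ^ (-(1 / (q + 1))),
    add_pos_of_pos_of_nonneg hc (setIntegral_nonneg measurableSet_Ioi fun t ht =>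
      Real.rpow_nonneg (intervalIntegral.integral_nonneg (hc.le.trans (le_of_lt ht))
        fun s _ => (hpos s).le) _), fun M₀ => ?_⟩
  set M := max M₀ c
  have hcM : c ≤ M := le_max_right _ _
  set φ : ℝ → ℝ := fun s => F (min s M)
  have hφ : Continuous φ := by fun_prop
  have hφmono : Monotone φ := fun s t hst => hmono (min_le_min_right M hst)
  have hφpos : ∀ s, 0 < φ s := fun s => hpos _
  have hφF : ∀ s ≤ M, φ s = F s := fun s hs => congrArg F (min_eq_left hs)
  have hφle : ∀ s, φ s ≤ F s := fun s => hmono (min_le_left _ _)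
  obtain ⟨Φ, hΦ, hΦmono, hinv⟩ := exists_hasDerivAt_speed_cutoffEnergy one_pos zero_le_one hq hφ
    hφmono hφpos (fun s => hmono (min_le_right s M)) 0
  have hH := cutoffEnergy_pos one_pos zero_le_one hφpos
  refine ⟨Φ, speed q (cutoffEnergy 1 1 φ), speedDeriv q (cutoffEnergy 1 1 φ) (cutoffSource 1 φ),
    fun s => hasDerivAt_speed (hasDerivAt_cutoffEnergy hφ s) (hH s),
    continuous_speedDeriv (continuous_cutoffEnergy hφ) (continuous_cutoffSource hφ) hH,
    fun s => speed_pos (hH s),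
    fun s => speedDeriv_nonneg hq (hH s) (cutoffSource_nonneg zero_le_one (hφpos s).le), hΦ,
    hΦmono, by simpa using hinv 0, ?_, fun s hs => ⟨?_, ?_⟩⟩
  · refine (le_max_left M₀ c).trans ((hinv M).ge.trans (hΦmono.monotone ?_))
    exact integral_inv_speed_cutoffEnergy_le hF hpos hq hc.le hcM hint hφ
      (fun s => (hφpos s).le) hφF
  · have := speed_cutoffEnergy_rpow_le one_pos hB.le zero_le_one hq hφ hφmono hφpos hs (hφle s)
      (hgrow s hs)
    rwa [hφF 0 (hc.le.trans hcM)] at this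
  · rw [speed_rpow_mul_speedDeriv hq (hH s), cutoffSource_of_nonneg hs, one_mul]
    exact div_le_div_of_nonneg_right (hφle s) (by positivity)

end Barrier

section Necessity

open Filter Set
open scoped Gradient Topology

theorem kellerOsserman_of_comp_add {F : ℝ → ℝ} {q a : ℝ} (hF : Continuous F)
    (hpos : ∀ t, 0 < F t) (hq : 0 < q) (ha : a ≤ 0)
    (hKO : KellerOsserman (fun s => F (s + a)) q) : KellerOsserman F q := by
  intro c hc
  rw [← (measurePreserving_add_right volume a).setLIntegral_comp_preimage_emb
    (MeasurableEquiv.addRight a).measurableEmbedding]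
  refine top_le_iff.1 ((hKO (c - a) (by linarith)).ge.trans ?_)
  rw [preimage_add_const_Ioi]
  refine setLIntegral_mono' measurableSet_Ioi fun t (ht : c - a < t) => ENNReal.ofReal_le_ofReal ?_
  rw [intervalIntegral.integral_comp_add_right, zero_add]
  exact Real.rpow_le_rpow_of_nonpos
    (intervalIntegral.intervalIntegral_pos_of_pos (hF.intervalIntegrable _ _) hpos (by linarith))
    (intervalIntegral.integral_mono_interval ha (by linarith) le_rfl
      (Eventually.of_forall fun s => (hpos s).le) (hF.intervalIntegrable _ _))
    (neg_nonpos.2 (by positivity))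

theorem exists_scaled_barrier_of_not_kellerOsserman {F : ℝ → ℝ} {q : ℝ} (hF : Continuous F)
    (hmono : Monotone F) (hpos : ∀ t, 0 < F t) (hq : 0 < q) (hKO : ¬ KellerOsserman F q) :
    ∃ B T : ℝ, 0 < T ∧ ∀ D : ℝ, 0 < D → ∀ M₀ : ℝ, ∃ Φ G G' : ℝ → ℝ,
      (∀ s, HasDerivAt G (G' s) s) ∧ Continuous G' ∧ (∀ s, 0 < G s) ∧ (∀ s, 0 ≤ G' s) ∧
      (∀ t, HasDerivAt Φ (G (Φ t)) t) ∧ StrictMono Φ ∧ Φ 0 = 0 ∧ M₀ ≤ Φ (T / D) ∧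
      ∀ s, 0 ≤ s → G s ^ q ≤ D ^ q * (B * F s) ∧
        G s ^ q * G' s ≤ D ^ q * D * (F s / (q + 1)) := by
  obtain ⟨B, T, hT, hbarrier⟩ := exists_barrier_of_not_kellerOsserman hF hmono hpos hq hKO
  refine ⟨B, T, hT, fun D hD M₀ => ?_⟩
  obtain ⟨Φ, G, G', hG, hG', hGpos, hG'0, hΦ, hΦmono, hΦ0, hΦM, hbound⟩ := hbarrier M₀
  refine ⟨fun t => Φ (D * t), fun s => D * G s, fun s => D * G' s, fun s => (hG s).const_mul D,
    hG'.const_mul D, fun s => mul_pos hD (hGpos s), fun s => mul_nonneg hD.le (hG'0 s),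
    fun t => ?_, fun s t hst => hΦmono (mul_lt_mul_of_pos_left hst hD), by simpa using hΦ0,
    by simpa only [mul_div_cancel₀ T hD.ne'] using hΦM, fun s hs => ?_⟩
  · simpa only [Function.comp_def, mul_comm, mul_one, id] using
      HasDerivAt.comp t (h := fun t => D * t) (hΦ (D * t)) ((hasDerivAt_id t).const_mul D)
  · rw [Real.mul_rpow hD.le (hGpos s).le]
    refine ⟨mul_le_mul_of_nonneg_left (hbound s hs).1 (by positivity), ?_⟩
    calc D ^ q * G s ^ q * (D * G' s) = D ^ q * D * (G s ^ q * G' s) := by ring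
      _ ≤ _ := mul_le_mul_of_nonneg_left (hbound s hs).2 (by positivity)

variable {n k : ℕ} {p α β m q : ℝ} {f Φ G G' : ℝ → ℝ} {u : EuclideanSpace ℝ (Fin n) → ℝ}

theorem exists_mul_div_rpow_lt {K τ b : ℝ} (hk : 1 ≤ k) (hα : -1 < α) (hq : 0 < q)
    (hmq : m * q = k) (hτ : 0 ≤ τ) (hb : 0 < b) :
    ∃ ρ : ℝ, 0 < ρ ∧ K * (τ / ρ ^ (1 + m)) ^ q < (b * ρ ^ α) ^ k := by
  have hk0 : (0 : ℝ) < k := by exact_mod_cast hk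
  have hexp : 0 < k * (α + 1) + q := add_pos (mul_pos hk0 (by linarith)) hq
  obtain ⟨ρ, hlarge, hρ⟩ := (((tendsto_rpow_atTop hexp).eventually
    (eventually_gt_atTop (K * τ ^ q / b ^ k))).and (eventually_gt_atTop 0)).exists
  refine ⟨ρ, hρ, ?_⟩
  rw [div_lt_iff₀ (by positivity)] at hlarge
  rw [Real.div_rpow hτ (by positivity), ← mul_div_assoc, div_lt_iff₀ (by positivity), mul_pow]
  refine hlarge.trans_eq ?_
  rw [← Real.rpow_natCast (ρ ^ α), ← Real.rpow_mul hρ.le, ← Real.rpow_mul hρ.le, mul_assoc,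
    ← Real.rpow_add hρ, mul_comm, add_mul 1 m, hmq]
  ring_nf

theorem min_one_rpow_mul_rpow_le {ρ c r : ℝ} (hρ : 0 < ρ) (hc : 0 < c) (h₁ : ρ ≤ r)
    (h₂ : r ≤ c * ρ) : min 1 (c ^ α) * ρ ^ α ≤ r ^ α := by
  rcases le_total 0 α with hα | hα
  · calc min 1 (c ^ α) * ρ ^ α ≤ 1 * ρ ^ α := by
          gcongr
          exact min_le_left _ _
      _ ≤ r ^ α := by
          rw [one_mul]
          gcongr
  · calc min 1 (c ^ α) * ρ ^ α ≤ c ^ α * ρ ^ α := by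
          gcongr
          exact min_le_right _ _
      _ ≤ r ^ α := by
          rw [← Real.mul_rpow hc.le hρ.le]
          exact Real.rpow_le_rpow_of_nonpos (hρ.trans_le h₁) h₂ hα

theorem IsEntireSubsolution.sub_const (hu : IsEntireSubsolution k p α β f u) (a : ℝ) :
    IsEntireSubsolution k p α β (fun s => f (s + a)) fun x => u x - a := by
  have hgrad : ∇ (fun x => u x - a) = ∇ u := by
    funext x
    rw [gradient, gradient, fderiv_sub_const]
  have hflux : pGradient p (fun x => u x - a) = pGradient p u := by
    funext x
    rw [pGradient, pGradient, hgrad]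
  refine ⟨hu.contDiff_one.sub contDiff_const, hu.contDiffOn_two.sub contDiffOn_const,
    fun ⟨c, hc⟩ => hu.nontrivial ⟨c + a, fun x => eq_add_of_sub_eq (hc x)⟩, fun x hx => ?_⟩
  have h := hu.subsolution x hx
  simpa only [IsAdmissibleSubsolutionAt, pHessian, hflux, hgrad, sub_add_cancel] using h

theorem IsEntireSubsolution.le_of_gradient_ne_zero (hu : IsEntireSubsolution k p α β f u)
    (hk : 1 ≤ k) {U : Set (EuclideanSpace ℝ (Fin n))} {M : ℝ} (hU : IsOpen U)
    (hM : ∀ y ∈ U, ∇ u y ≠ 0 → u y ≤ M) {x : EuclideanSpace ℝ (Fin n)} (hxU : x ∈ U)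
    (hx : x ≠ 0) : u x ≤ M := by
  by_contra! hlt
  obtain ⟨z, hgrad, hz, hzU⟩ := ((hu.frequently_gradient_ne_zero hk hx).and_eventually
    ((hu.contDiff_one.continuous.continuousAt.eventually (lt_mem_nhds hlt)).and
      (hU.mem_nhds hxU))).exists
  exact (hM z hzU hgrad).not_gt hz

theorem IsEntireSubsolution.le_of_barrier (hu : IsEntireSubsolution k p α β f u) (hk : 1 ≤ k)
    (hp : 1 < p) (hm : 0 < m) (hq : q = k * (p - β - 1)) (hmq : m * q = k)
    (hf_mono : Monotone f) (hf_pos : ∀ t, 0 < f t) (hG : ∀ s, HasDerivAt G (G' s) s)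
    (hG' : Continuous G') (hGpos : ∀ s, 0 < G s) (hG'0 : ∀ s, 0 ≤ G' s)
    (hΦ : ∀ t, HasDerivAt Φ (G (Φ t)) t) {ρ L : ℝ} (hρ : 0 ≤ ρ) (hL : 0 ≤ L)
    {y : EuclideanSpace ℝ (Fin n)} (hy : ∇ u y ≠ 0)
    (hbd : ∀ x, ‖x - y‖ = ρ → u x ≤ Φ (ρ ^ (1 + m) / (1 + m)))
    (hball : ∀ x, ‖x - y‖ < ρ → x ≠ 0 ∧ L ≤ ‖x‖ ^ α)
    (hineq : ∀ x, ‖x - y‖ < ρ → 2 ^ n * (((p - 1) *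
      (G' (radialFun Φ m y x) * ‖x - y‖ ^ (m + 1) + m) + 1) * G (radialFun Φ m y x) ^ q) <
        (L * f (radialFun Φ m y x)) ^ k) :
    u y ≤ Φ 0 := by
  by_contra! hlt
  have hv : ContDiff ℝ 1 (radialFun Φ m y) := contDiff_radialFun
    ((contDiff_two_of_hasDerivAt_comp_self hG hG' hΦ).of_le (by norm_num))
    (contDiff_norm_rpow (by linarith))
  have hvy : radialFun Φ m y y = Φ 0 := by
    simp [radialFun, Real.zero_rpow (by linarith : 1 + m ≠ 0)]
  obtain ⟨x, hxρ, hyx, hmax⟩ := exists_isLocalMax_of_forall_norm_sub_eq_lt (y := y)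
    (w := fun z => u z - radialFun Φ m y z) (hu.contDiff_one.continuous.sub hv.continuous) hρ
    fun x hx => by
      rw [hvy, radialFun, hx]
      linarith [hbd x hx]
  have hxy : x ≠ y := by
    rintro rfl
    refine hy ?_
    rw [gradient_eq_of_isLocalMax_sub (hu.contDiff_one.differentiable one_ne_zero x)
      (hv.differentiable one_ne_zero x) hmax, gradient_radialFun hm hΦ]
    simp
  obtain ⟨hx, hLx⟩ := hball x hxρ
  have hvx : f (radialFun Φ m y x) ≤ f (u x) := hf_mono (by linarith)
  refine (hineq x hxρ).not_ge (le_trans ?_ (hu.pow_le_of_isLocalMax_sub_radialFun hk hp hm hq hmq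
    hf_pos hG hG' hGpos hG'0 hΦ hx hxy hmax))
  have := (hf_pos (radialFun Φ m y x)).le
  gcongr

theorem barrier_inequality {B D E L g g' r y τ : ℝ} (hp : 1 < p) (hm : 0 < m) (hq : 0 < q)
    (hD : 0 < D) (hr : 0 ≤ r) (hy : 0 < y) (hrE : r ^ (m + 1) ≤ E)
    (hDE : D * E = τ) (hB : g ^ q ≤ D ^ q * (B * y)) (hODE : g ^ q * g' ≤ D ^ q * D * (y / (q + 1)))
    (hL : 2 ^ n * ((p - 1) * (τ / (q + 1)) + ((p - 1) * m + 1) * B) * D ^ q < L ^ k) :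
    2 ^ n * (((p - 1) * (g' * r ^ (m + 1) + m) + 1) * g ^ q) < L ^ k * y := by
  have : 0 < p - 1 := sub_pos.2 hp
  calc 2 ^ n * (((p - 1) * (g' * r ^ (m + 1) + m) + 1) * g ^ q)
      = 2 ^ n * ((p - 1) * (g ^ q * g' * r ^ (m + 1)) + ((p - 1) * m + 1) * g ^ q) := by ring
    _ ≤ 2 ^ n * ((p - 1) * (D ^ q * D * (y / (q + 1)) * E) +
          ((p - 1) * m + 1) * (D ^ q * (B * y))) := by gcongr
    _ = 2 ^ n * ((p - 1) * (τ / (q + 1)) + ((p - 1) * m + 1) * B) * D ^ q * y := by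
        rw [← hDE]
        ring
    _ < L ^ k * y := mul_lt_mul_of_pos_right hL hy

theorem IsEntireSubsolution.exists_annulus_le (hu : IsEntireSubsolution k p α β f u)
    (hk : 1 ≤ k) (hp : 1 < p) (hα : -1 < α) (hβ : β < p - 1) (hf_cont : Continuous f)
    (hf_mono : Monotone f) (hf_pos : ∀ t, 0 < f t)
    (hKO : ¬ KellerOsserman (fun s => f s ^ k) (k * (p - β - 1))) :
    ∃ ρ : ℝ, 0 < ρ ∧ ∀ y, 2 * ρ < ‖y‖ ∧ ‖y‖ < 3 * ρ → ∇ u y ≠ 0 → u y ≤ 0 := by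
  have hpβ : 0 < p - β - 1 := by linarith
  set q : ℝ := k * (p - β - 1) with hq
  set m : ℝ := 1 / (p - β - 1) with hm_def
  have hq0 : 0 < q := by positivity
  have hm : 0 < m := by positivity
  have hmq : m * q = k := by
    rw [hm_def, hq]
    field_simp
  obtain ⟨B, T, hT, hbarrier⟩ := exists_scaled_barrier_of_not_kellerOsserman
    (F := fun s => f s ^ k) (hf_cont.pow k)
    (fun s t hst => pow_le_pow_left₀ (hf_pos s).le (hf_mono hst) k)
    (fun t => pow_pos (hf_pos t) k) hq0 hKO
  obtain ⟨ρ, hρ, hK⟩ := exists_mul_div_rpow_lt (τ := T * (1 + m)) (b := min 1 (4 ^ α))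
    (K := 2 ^ n * ((p - 1) * (T * (1 + m) / (q + 1)) + ((p - 1) * m + 1) * B)) hk hα hq0 hmq
    (by positivity) (by positivity)
  refine ⟨ρ, hρ, fun y hy hgrad => ?_⟩
  obtain ⟨M₀, hM₀⟩ :=
    (isCompact_sphere y ρ).bddAbove_image hu.contDiff_one.continuous.continuousOn
  obtain ⟨Φ, G, G', hG, hG', hGpos, hG'0, hΦ, hΦmono, hΦ0, hΦM, hbound⟩ :=
    hbarrier (T * (1 + m) / ρ ^ (1 + m)) (by positivity) M₀
  rw [show T / (T * (1 + m) / ρ ^ (1 + m)) = ρ ^ (1 + m) / (1 + m) by field_simp] at hΦM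
  rw [← hΦ0]
  have hnorm : ∀ x, ‖x - y‖ < ρ → ρ < ‖x‖ ∧ ‖x‖ < 4 * ρ := fun x hx => by
    have h := abs_le.1 (abs_norm_sub_norm_le x y)
    constructor <;> linarith
  refine hu.le_of_barrier hk hp hm hq hmq hf_mono hf_pos hG hG' hGpos hG'0 hΦ hρ.le
    (L := min 1 (4 ^ α) * ρ ^ α) (by positivity) hgrad
    (fun x hx => (hM₀ (mem_image_of_mem u (mem_sphere_iff_norm.2 hx))).trans hΦM)
    (fun x hx => ⟨norm_pos_iff.1 (hρ.trans (hnorm x hx).1), min_one_rpow_mul_rpow_le hρ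
      (by norm_num) (hnorm x hx).1.le (hnorm x hx).2.le⟩) fun x hx => ?_
  have hs : 0 ≤ radialFun Φ m y x := hΦ0.symm.trans_le (hΦmono.monotone (by positivity))
  rw [mul_pow]
  exact barrier_inequality hp hm hq0 (by positivity) (norm_nonneg _)
    (pow_pos (hf_pos _) k) (Real.rpow_le_rpow (norm_nonneg _) hx.le (by positivity))
    (by rw [add_comm m 1]; field_simp) (hbound _ hs).1 (hbound _ hs).2 hK

theorem IsEntireSubsolution.kellerOsserman_of_pos (hu : IsEntireSubsolution k p α β f u)
    (hn : 0 < n) (hk : 1 ≤ k) (hp : 1 < p) (hα : -1 < α) (hβ : β < p - 1)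
    (hf_cont : Continuous f) (hf_mono : Monotone f) (hf_pos : ∀ t, 0 < f t) (h0 : 0 < u 0) :
    KellerOsserman (fun s => f s ^ k) (k * (p - β - 1)) := by
  by_contra hKO
  obtain ⟨ρ, hρ, hann⟩ := hu.exists_annulus_le hk hp hα hβ hf_cont hf_mono hf_pos hKO
  have hopen : IsOpen {y : EuclideanSpace ℝ (Fin n) | 2 * ρ < ‖y‖ ∧ ‖y‖ < 3 * ρ} :=
    (isOpen_lt continuous_const continuous_norm).inter (isOpen_lt continuous_norm continuous_const)
  refine h0.not_ge (hu.le_of_forall_norm_eq hn hk hp.le (ρ := 5 / 2 * ρ) (by positivity)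
    fun x hx => hu.le_of_gradient_ne_zero hk hopen hann ?_ ?_)
  · constructor <;> linarith
  · exact norm_pos_iff.1 (hx ▸ by positivity)

theorem IsEntireSubsolution.kellerOsserman (hu : IsEntireSubsolution k p α β f u)
    (hn : 0 < n) (hk : 1 ≤ k) (hp : 1 < p) (hα : -1 < α) (hβ : β < p - 1)
    (hf_cont : Continuous f) (hf_mono : Monotone f) (hf_pos : ∀ t, 0 < f t) :
    KellerOsserman (fun s => f s ^ k) (k * (p - β - 1)) := by
  set a := min (u 0 - 1) 0
  have hpβ : 0 < p - β - 1 := by linarith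
  refine kellerOsserman_of_comp_add (hf_cont.pow k) (fun t => pow_pos (hf_pos t) k)
    (by positivity) (min_le_right _ _ : a ≤ 0) ?_
  exact (hu.sub_const a).kellerOsserman_of_pos hn hk hp hα hβ (by fun_prop)
    (hf_mono.comp (monotone_id.add_const a)) (fun t => hf_pos _)
    (by linarith [(min_le_left _ _ : a ≤ u 0 - 1)])

end Necessity

theorem theorem4p2_general (n k : ℕ) (hk : 1 ≤ k) (hkn : k ≤ n) (p α β : ℝ) (f : ℝ → ℝ)
    (hf_cont : Continuous f) (hf_mono : Monotone f) (hf_pos : ∀ t, 0 < f t)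
    (hα : -1 < α) (hβ : β < p - 1) (hp : 1 < p) :
    (∀ κ : ℝ, 1 ≤ κ → KellerOsserman (fun s => f s ^ (κ * k)) (κ * k * (p - β - 1)) →
      ∃ u : EuclideanSpace ℝ (Fin n) → ℝ, IsEntireSubsolution k p α β f u ∧
        (p ≤ α + β + 2 → ContDiff ℝ 2 u) ∧
        (α + β + 2 < p → ∀ δ : ℝ, 0 < δ → δ * (p - α - β - 2) < n * (p - β - 1) →
          MemW2Loc δ u)) ∧
    ((∃ u : EuclideanSpace ℝ (Fin n) → ℝ, IsEntireSubsolution k p α β f u) →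
      KellerOsserman (fun s => f s ^ k) (k * (p - β - 1))) := by
  have hn : 0 < n := hk.trans hkn
  have hpβ : 0 < p - β - 1 := by linarith
  refine ⟨fun κ hκ hKO => ?_, fun ⟨u, hu⟩ =>
    hu.kellerOsserman hn hk hp hα hβ hf_cont hf_mono hf_pos⟩
  obtain ⟨Φ, hΦ, hu⟩ := exists_isEntireSubsolution_radialFun hk hkn hp hα hβ hf_cont hf_mono hf_pos
    hκ hKO rfl
  refine ⟨_, hu, fun hle => ?_, fun hlt δ hδ hδn => ?_⟩
  · have hm : 1 ≤ (α + 1) / (p - β - 1) := (one_le_div hpβ).2 (by linarith)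
    exact contDiff_radialFun hΦ (contDiff_two_norm_rpow (by linarith))
  · have hm : (α + 1) / (p - β - 1) ≤ 1 := (div_le_one hpβ).2 (by linarith)
    have hmδ : (1 - (α + 1) / (p - β - 1)) * δ = δ * (p - α - β - 2) / (p - β - 1) := by
      field_simp
      ring
    exact memW2Loc_radialFun hn (div_pos (by linarith) hpβ) hm hΦ hδ
      (by rwa [hmδ, div_lt_iff₀ hpβ])

theorem one_le_one_sub_div_sub {k : ℕ} {α ε : ℝ} (hk : 1 ≤ k) (hα : α < 1 / (k : ℝ) - 1)
    (hε : ε < k * (α + 1)) : 1 ≤ (1 - ε) / (k * (α + 1) - ε) := by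
  have hk0 : (0 : ℝ) < k := by exact_mod_cast hk
  have hlt : k * (α + 1) < 1 := by
    rw [mul_comm]
    exact (lt_div_iff₀ hk0).1 (by linarith)
  exact (one_le_div (by linarith)).2 (by linarith)

theorem theorem4p2 (n k : ℕ) (hk : 1 ≤ k) (hkn : k ≤ n) (p α β : ℝ) (f : ℝ → ℝ)
    (hf_cont : Continuous f) (hf_mono : Monotone f) (hf_pos : ∀ t, 0 < f t)
    (hα : -1 < α) (hα' : α < 1 / (k : ℝ) - 1) (hβ : β < p - 1) (hp : 1 < p) :
    (∀ ε ∈ Set.Ioo (0 : ℝ) (k * (α + 1)), ∀ κ : ℝ, κ = (1 - ε) / (k * (α + 1) - ε) →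
      KellerOsserman (fun s => f s ^ (κ * k)) (κ * k * (p - β - 1)) →
      ∃ u : EuclideanSpace ℝ (Fin n) → ℝ, IsEntireSubsolution k p α β f u ∧
        (p ≤ α + β + 2 → ContDiff ℝ 2 u) ∧
        (α + β + 2 < p → 0 ≤ (p - 1) * α + β →
          ∀ δ ∈ Set.Ioo (1 : ℝ) ((p - β - 1) / (p - α - β - 2)), MemW2Loc δ u)) ∧
    ((∃ u : EuclideanSpace ℝ (Fin n) → ℝ, IsEntireSubsolution k p α β f u ∧
        ((p ≤ α + β + 2 ∧ ContDiff ℝ 2 u) ∨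
          (α + β + 2 < p ∧ 0 ≤ (p - 1) * α + β ∧
            ∃ δ ∈ Set.Ioo (1 : ℝ) ((p - β - 1) / (p - α - β - 2)), MemW2Loc δ u))) →
      KellerOsserman (fun s => f s ^ k) (k * (p - β - 1))) := by
  have hn : (1 : ℝ) ≤ n := by exact_mod_cast hk.trans hkn
  obtain ⟨hsuff, hnec⟩ :=
    theorem4p2_general n k hk hkn p α β f hf_cont hf_mono hf_pos hα hβ hp
  refine ⟨fun ε hε κ hκ hKO => ?_, fun ⟨u, hu, _⟩ => hnec ⟨u, hu⟩⟩
  obtain ⟨u, hu, hC2, hW2⟩ := hsuff κ (hκ ▸ one_le_one_sub_div_sub hk hα' hε.2) hKO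
  refine ⟨u, hu, hC2, fun hlt _ δ hδ => hW2 hlt δ (by linarith [hδ.1]) ?_⟩
  calc δ * (p - α - β - 2) < p - β - 1 := (lt_div_iff₀ (by linarith)).1 hδ.2
    _ ≤ n * (p - β - 1) := le_mul_of_one_le_left (by linarith) hn
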